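/- **Setting.** Fix integers $1\le l\le r$ and put $t=l+r$. For each $N\in\mathbb N$ let $A^{(1)},\dots,A^{(t)}$ (depending on $N$) be binary matrices, $A^{(i)}:\mathbb F_2^{n_i}\to\mathbb F_2^{m_i}$, viewed as complexes with $\mathbb F_2^{n_i}$ in degree $1$ and $\mathbb F_2^{m_i}$ in degree $0$, and let $\mathcal F_\bullet$ be their tensor product. Let $\mathcal Q_N$ be the $t$-dimensional hypergraph product code with qubits on the standard basis of $\mathcal F_l$, i.e. the CSS code of $\mathcal F_{l+1}\xrightarrow{\partial_{l+1}}\mathcal F_l\xrightarrow{\partial_l}\mathcal F_{l-1}$ with $Z$-stabilizers $\operatorname{im}\partial_{l+1}$ and $X$-stabilizers $\operatorname{im}\partial_l^T$; its canonical $Z$ (resp. $X$) logical representatives have dimension $l$ (resp. $r$). Let $k_i,d_i$ and $k_i^T,d_i^T$ be the dimension and minimum distance of $\ker A^{(i)}$ and $\ker (A^{(i)})^T$ (the zero code has distance $\infty$). A *sector* $S_\mu$ of $\mathcal F_l$ is given by an $l$-element set $\mu\subset[t]$; its qubits are the points of the $t$-dimensional box whose $i$-th axis is $[n_i]$ for $i\in\mu$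 and $[m_i]$ for $i\notin\mu$. A *hypertube* is a product region $R=R_1\times\dots\times R_t$ in one sector. For $C\in\mathbb N$ its *dimension at resolution $C$*, $\dim_C R$, is the number of axes $i$ with $C|R_i|\ge\min(d_i,d_i^T)$. For a unitary $V$ and a set $R$ of qubits let $\Phi_V(R)$ be the union of $R$ and the supports of all $VBV^\dagger$, where $B$ is an operator supported on $R$. Call a family $(V_N)_N$ * *constant-depth* if there are $w,D$ such that every $V_N$ is a product of at most $D$ layers of unitary gates with disjoint supports of at most $w$ qubits; * *shape-preserving* if there is a constant $c$ such that for every $N$ and every hypertube $R$ there are hypertubes $T_{\sigma,\nu}$ in the sectors $S_\nu$, for $\sigma\in \mathfrak S_t$, with $|(T_{\sigma,\nu})_i|\le c\,|R_{\sigma(i)}|$ for all $i$ and $\Phi_{V_N}(R)\subseteq\bigcup_{\sigma,\nu}T_{\sigma,\nu}$; * *dimension-preserving* if there is a constant $M$ such that for every $C$ there is a $C'$ such that for every $N$ and every hypertube $R$, $\Phi_{V_N}(R)$ is contained in a union of $M$ hypertubes $T$, in possibly different sectors, with $\dim_C T\le\dim_{C'}R$. **Theorem.** Suppose that $\max(k_i,k_i^T)=o(\min(d_i,d_i^T))$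 as $N\to\infty$ for every $i\in[t]$ (i.e. for each $C$, $C\max(k_i,k_i^T)\le\min(d_i,d_i^T)$ for all large $N$). For every $N$ let $U_N$ be a unitary that preserves the code space of $\mathcal Q_N$, such that the family $(U_N)$ is constant-depth and shape-preserving, and the families $(U_N)$ and $(U_N^\dagger)$ are dimension-preserving. Then for all sufficiently large $N$ the logical gate implemented by $U_N$ on the logical qubits of $\mathcal Q_N$ lies in level $\lfloor r/l\rfloor+1$ of the Clifford hierarchy, for every choice of the logical $X$ operators as a basis of $\ker\partial_{l+1}^T/\operatorname{im}\partial_l^T$, with the dual logical $Z$ operators. Here level $1$ is the Pauli group with phases $\pm1,\pm i$, and level $j+1$ consists of the unitaries $V$ with $VPV^\dagger P^\dagger$ in level $j$ for all Pauli operators $P$. -/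

import Mathlib

open scoped Matrix

namespace HGP

/-! ## Classical codes -/

/-- Dimension of the binary linear code `ker H`. -/
noncomputable def codeDim {a b : ℕ} (H : Matrix (Fin a) (Fin b) (ZMod 2)) : ℕ :=
  Module.finrank (ZMod 2) (LinearMap.ker H.mulVecLin)

/-- Distance of the binary linear code `ker H`: the least Hamming weight of a nonzero codeword.
The zero code has distance `⊤`. -/
noncomputable def codeDist {a b : ℕ} (H : Matrix (Fin a) (Fin b) (ZMod 2)) : ℕ∞ :=
  ⨅ x : {x : Fin b → ZMod 2 // H *ᵥ x = 0 ∧ x ≠ 0}, (hammingNorm x.1 : ℕ∞)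

/-- `max (k, kᵀ)` for a parity-check matrix. -/
noncomputable def kMax {a b : ℕ} (H : Matrix (Fin a) (Fin b) (ZMod 2)) : ℕ :=
  max (codeDim H) (codeDim Hᵀ)

/-- `min (d, dᵀ)` for a parity-check matrix. -/
noncomputable def dMin {a b : ℕ} (H : Matrix (Fin a) (Fin b) (ZMod 2)) : ℕ∞ :=
  min (codeDist H) (codeDist Hᵀ)

/-! ## The homological product -/

/-- `t` classical seed codes `A i : 𝔽₂ ^ (n i) → 𝔽₂ ^ (m i)`, that is, `t` complexes with one
boundary map, with `𝔽₂ ^ (n i)` in degree `1` and `𝔽₂ ^ (m i)` in degree `0`. -/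
structure SeedCodes (t : ℕ) where
  n : Fin t → ℕ
  m : Fin t → ℕ
  A : ∀ i, Matrix (Fin (m i)) (Fin (n i)) (ZMod 2)

/-- Basis elements of the product complex (in all degrees): in each tensor factor a basis element
of degree one (`Sum.inl`) or of degree zero (`Sum.inr`). -/
abbrev Cell {t : ℕ} (S : SeedCodes t) : Type :=
  ∀ i, Fin (S.n i) ⊕ Fin (S.m i)

/-- The set of tensor factors in which a basis element has degree one. -/
def cellSector {t : ℕ} {S : SeedCodes t} (x : Cell S) : Finset (Fin t) :=
  Finset.univ.filter fun i => (x i).isLeft = true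

/-- Basis of the space of `p`-chains `F_p`. -/
abbrev CellAt {t : ℕ} (S : SeedCodes t) (p : ℕ) : Type :=
  {x : Cell S // (cellSector x).card = p}

/-- Matrix entry of the boundary map of the product complex (graded Leibniz rule over `𝔽₂`): the
sum over `j` of the maps acting by `A j` on the `j`-th factor and by the identity on the others. -/
def boundaryEntry {t : ℕ} (S : SeedCodes t) (y x : Cell S) : ZMod 2 :=
  ∑ j, match x j, y j with
    | Sum.inl a, Sum.inr b => if ∀ i, i ≠ j → x i = y i then S.A j b a else 0
    | _, _ => 0

/-- The boundary map `F_q → F_p` (used with `q = p + 1`). -/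
def boundary {t : ℕ} (S : SeedCodes t) (p q : ℕ) : Matrix (CellAt S p) (CellAt S q) (ZMod 2) :=
  fun y x => boundaryEntry S y.1 x.1

/-! ## Operators on qubits -/

/-- Operators on qubits labelled by `Q`, in the computational basis. -/
abbrev Op (Q : Type) : Type := Matrix (Q → ZMod 2) (Q → ZMod 2) ℂ

section Qubits

variable {Q : Type} [Fintype Q] [DecidableEq Q]

/-- The Pauli operator `|y⟩ ↦ |y + a⟩`. -/
def pauliX (a : Q → ZMod 2) : Op Q := fun x y => if x = y + a then 1 else 0

/-- The Pauli operator `|x⟩ ↦ (-1) ^ (b · x) |x⟩`. -/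
def pauliZ (b : Q → ZMod 2) : Op Q := Matrix.diagonal fun x => (-1 : ℂ) ^ (b ⬝ᵥ x).val

/-- The Pauli group, with phases `±1, ±i`. -/
def pauliGroup (Q : Type) [Fintype Q] [DecidableEq Q] : Set (Op Q) :=
  {P | ∃ (s : ℕ) (a b : Q → ZMod 2), P = Complex.I ^ s • (pauliX a * pauliZ b)}

/-- The levels of the Clifford hierarchy: level `0` is `{±1, ±i}`, level `1` is the Pauli group,
and level `j + 1` (`j ≥ 1`) consists of the unitaries `V` with `V P V† P†` in level `j` for every
Pauli operator `P`. -/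
def cliffordHierarchy (Q : Type) [Fintype Q] [DecidableEq Q] : ℕ → Set (Op Q)
  | 0 => {P | ∃ s : ℕ, P = Complex.I ^ s • (1 : Op Q)}
  | 1 => pauliGroup Q
  | j + 2 => {V | V ∈ Matrix.unitaryGroup (Q → ZMod 2) ℂ ∧
      ∀ P ∈ pauliGroup Q, V * P * Vᴴ * Pᴴ ∈ cliffordHierarchy Q (j + 1)}

/-- `B` acts as the identity on qubit `q`: `B = 1 ⊗ B'` with the first factor on `q`. -/
def ActsTriviallyAt (B : Op Q) (q : Q) : Prop :=
  ∀ x y, B x y = if x q = y q then B (Function.update x q 0) (Function.update y q 0) else 0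

/-- The set of qubits on which `B` acts nontrivially. -/
def opSupport (B : Op Q) : Set Q := {q | ¬ ActsTriviallyAt B q}

/-- The support map of `V` on a region `R`: the region `R` together with the supports of all
`V B V†`, where `B` is an operator supported on `R`. -/
def supportMap (V : Op Q) (R : Set Q) : Set Q :=
  R ∪ {q | ∃ B : Op Q, opSupport B ⊆ R ∧ q ∈ opSupport (V * B * Vᴴ)}

/-- One layer of a circuit: a product of unitary gates with disjoint supports, each acting on at
most `w` qubits. -/
def IsLayer (w : ℕ) (G : Op Q) : Prop :=
  ∃ gates : List (Finset Q × Op Q),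
    (∀ g ∈ gates, g.1.card ≤ w ∧ g.2 ∈ Matrix.unitaryGroup (Q → ZMod 2) ℂ ∧
      opSupport g.2 ⊆ g.1) ∧
    (gates.Pairwise fun g h => Disjoint g.1 h.1) ∧
    G = (gates.map Prod.snd).prod

/-- `V` is implemented by a circuit of depth at most `D` made of gates on at most `w` qubits. -/
def IsCircuit (w D : ℕ) (V : Op Q) : Prop :=
  ∃ layers : List (Op Q), layers.length ≤ D ∧ (∀ G ∈ layers, IsLayer w G) ∧ V = layers.prod

/-- The code space of the CSS code with `X`-stabilizers `SX` and `Z`-stabilizers `SZ`. -/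
def codeSpace (SX SZ : Submodule (ZMod 2) (Q → ZMod 2)) :
    Submodule ℂ ((Q → ZMod 2) → ℂ) where
  carrier := {ψ | (∀ a ∈ SX, pauliX a *ᵥ ψ = ψ) ∧ ∀ b ∈ SZ, pauliZ b *ᵥ ψ = ψ}
  add_mem' := by
    rintro ψ φ ⟨h1, h2⟩ ⟨h3, h4⟩
    exact ⟨fun a ha => by rw [Matrix.mulVec_add, h1 a ha, h3 a ha],
      fun b hb => by rw [Matrix.mulVec_add, h2 b hb, h4 b hb]⟩
  zero_mem' := ⟨fun a _ => Matrix.mulVec_zero _, fun b _ => Matrix.mulVec_zero _⟩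
  smul_mem' := by
    rintro c ψ ⟨h1, h2⟩
    exact ⟨fun a ha => by rw [Matrix.mulVec_smul, h1 a ha],
      fun b hb => by rw [Matrix.mulVec_smul, h2 b hb]⟩

/-- `V` is a logical gate: a unitary that preserves the code space, `V Π V† = Π`. -/
def IsLogicalGate (SX SZ : Submodule (ZMod 2) (Q → ZMod 2)) (V : Op Q) : Prop :=
  V ∈ Matrix.unitaryGroup (Q → ZMod 2) ℂ ∧
    (codeSpace SX SZ).map V.mulVecLin = codeSpace SX SZ

/-- `L` is a choice of logical `X` operators of `k` logical qubits: the `X`-type operators `L i`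
commute with all `Z`-stabilizers, and modulo `X`-stabilizers they form a basis of the space of
`X`-type operators that do so. The dual logical `Z` operators are then determined modulo
stabilizers. -/
def IsLogicalBasis (SX SZ : Submodule (ZMod 2) (Q → ZMod 2)) {k : ℕ}
    (L : Fin k → Q → ZMod 2) : Prop :=
  (∀ i, ∀ b ∈ SZ, b ⬝ᵥ L i = 0) ∧
    ∀ v : Q → ZMod 2, (∀ b ∈ SZ, b ⬝ᵥ v = 0) →
      ∃! a : Fin k → ZMod 2, v - ∑ i, a i • L i ∈ SX

open Classical in
/-- The encoding isometry of the logical qubits given by `L`: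
`|a⟩ ↦ |SX|^(-1/2) ∑_{s ∈ SX} |∑ i, a i • L i + s⟩`. It intertwines the logical Pauli operators
on the code with the Pauli operators on `k` qubits. -/
noncomputable def encoder (SX : Submodule (ZMod 2) (Q → ZMod 2)) {k : ℕ}
    (L : Fin k → Q → ZMod 2) : Matrix (Q → ZMod 2) (Fin k → ZMod 2) ℂ :=
  fun x a => if x - ∑ i, a i • L i ∈ SX then ((Real.sqrt (Nat.card SX))⁻¹ : ℝ) else 0

/-- The gate on `k` qubits that a logical gate `V` implements on the encoded qubits. -/
noncomputable def encodedGate (SX : Submodule (ZMod 2) (Q → ZMod 2)) {k : ℕ}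
    (L : Fin k → Q → ZMod 2) (V : Op Q) : Op (Fin k) :=
  (encoder SX L)ᴴ * V * encoder SX L

end Qubits

/-! ## The hypergraph product code with qubits on `F_l` -/

/-- `X`-stabilizers: the row space of `∂_l : F_l → F_{l-1}`. -/
noncomputable def xStab {t : ℕ} (S : SeedCodes t) (l : ℕ) :
    Submodule (ZMod 2) (CellAt S l → ZMod 2) :=
  LinearMap.range ((boundary S (l - 1) l)ᵀ).mulVecLin

/-- `Z`-stabilizers: the image of `∂_{l+1} : F_{l+1} → F_l`. -/
noncomputable def zStab {t : ℕ} (S : SeedCodes t) (l : ℕ) :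
    Submodule (ZMod 2) (CellAt S l → ZMod 2) :=
  LinearMap.range (boundary S l (l + 1)).mulVecLin

/-! ## Hypertubes -/

/-- A sector of `F_l`: the `l` tensor factors that are in degree one. -/
abbrev Sector (t l : ℕ) : Type := {μ : Finset (Fin t) // μ.card = l}

/-- A hypertube in the sector `μ`, a product region. Its `i`-th side is a set of positions along
the `i`-th axis of that sector, which is `[n i]` if `i ∈ μ` and `[m i]` otherwise. -/
structure Hypertube {t : ℕ} (S : SeedCodes t) {l : ℕ} (μ : Sector t l) where
  side : ∀ i, Finset (Fin (S.n i) ⊕ Fin (S.m i))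
  side_sector : ∀ i, ∀ a ∈ side i, a.isLeft = true ↔ i ∈ μ.1

/-- The set of qubits in a hypertube. -/
def Hypertube.region {t : ℕ} {S : SeedCodes t} {l : ℕ} {μ : Sector t l} (R : Hypertube S μ) :
    Set (CellAt S l) :=
  {q | ∀ i, q.1 i ∈ R.side i}

open Classical in
/-- The dimension of a hypertube at resolution `C`: the number of axes along which it is long,
that is, `C` times the length of the side is at least `min (d, dᵀ)` of the seed code of that axis.
The other axes form the orientation of the hypertube. At resolution `1`, an axis is long when
the length of the side is at least `min (d, dᵀ)`. -/
noncomputable def Hypertube.dim {t : ℕ} {S : SeedCodes t} {l : ℕ} {μ : Sector t l} (C : ℕ)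
    (R : Hypertube S μ) : ℕ :=
  (Finset.univ.filter fun i => dMin (S.A i) ≤ ((C * (R.side i).card : ℕ) : ℕ∞)).card

/-! ## Families of circuits -/

/-- Constant-depth circuits: depth and gate size are bounded along the family. -/
def IsConstantDepth {t l : ℕ} {S : ℕ → SeedCodes t} (U : ∀ N, Op (CellAt (S N) l)) : Prop :=
  ∃ w D : ℕ, ∀ N, IsCircuit w D (U N)

/-- Shape-preserving circuits: the support map sends every hypertube `R` into a union, over all
permutations `σ` of the axes, of regions that are hypertubes in each sector, with `i`-th side of
length `O(length of the σ(i)-th side of R)`. -/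
def IsShapePreserving {t l : ℕ} {S : ℕ → SeedCodes t} (U : ∀ N, Op (CellAt (S N) l)) : Prop :=
  ∃ c : ℕ, ∀ (N : ℕ) (μ : Sector t l) (R : Hypertube (S N) μ),
    ∃ T : Equiv.Perm (Fin t) → ∀ ν : Sector t l, Hypertube (S N) ν,
      (∀ σ ν i, ((T σ ν).side i).card ≤ c * (R.side (σ i)).card) ∧
      supportMap (U N) R.region ⊆ ⋃ σ, ⋃ ν, (T σ ν).region

/-- Dimension-preserving families of operators: the support map sends every hypertube into a union
of a constant number of hypertubes, in possibly different sectors, whose dimension is at most that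
of the given one. Being short along an axis is understood up to constant factors: for every
resolution `C` of the images there is a resolution `C'` of the given hypertube, the same for the
whole family. So axes along which the sides are `o(min (d, dᵀ))` keep being counted as short. -/
def IsDimensionPreserving {t l : ℕ} {S : ℕ → SeedCodes t} (U : ∀ N, Op (CellAt (S N) l)) :
    Prop :=
  ∃ M : ℕ, ∀ C : ℕ, ∃ C' : ℕ, ∀ (N : ℕ) (μ : Sector t l) (R : Hypertube (S N) μ),
    ∃ (ν : Fin M → Sector t l) (T : ∀ a, Hypertube (S N) (ν a)),
      (∀ a, (T a).dim C ≤ R.dim C') ∧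
      supportMap (U N) R.region ⊆ ⋃ a, (T a).region

end HGP

set_option linter.unusedSectionVars false
set_option linter.unusedVariables false
namespace HGP

/-! The proof is a cleaning argument in the style of Bravyi and König, with the dimension of
hypertubes in the role of geometric dimension. The dual of the quotient of `𝔽₂ ^ n` by the row space
of a seed matrix is its code, so the unit vectors off any set smaller than the distance still span
this quotient. They contain a basis of `k` elements, an information set, onto which the seed complex
retracts up to homotopy in the relevant degree. Using these homotopies axis by axis, each logical
`X` (resp. `Z`) operator gets a representative that occupies, along the `l` axes in degree one
(resp. the `r ≥ l` axes in degree zero), only information sets off prescribed positions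
(`exists_cocycle_representative`, `exists_cycle_representative`).

Let the support of a gate be covered by boundedly many hypertubes of dimension at most `d`. Their
short sides together fill fewer positions than the distance, so the information sets can avoid them.
A representative then meets a hypertube only if the hypertube is long along at least `l` thin axes
of the representative, and the intersection is short there because `k = o(d)` for the seed codes.
Hence the dimension drops by `l`, and the intersection is empty if `d < l` (`covered_inter_thin`,
`exists_logical_pauli`). The commutator of the gate with this logical Pauli is supported on the
image of the intersection under the support map, and it again spreads hypertubes boundedly since
Paulis do not spread anything.

Starting from dimension `l + r`, taking `r / l + 1` commutators leaves dimension less than `l`,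
where the gate commutes with all logical Paulis and is a scalar (`mem_projLevel_of_covered`). This
places the gate in the hierarchy up to phases; from level two on the phases take care of themselves
(`projLevel_add_two_subset`). -/

theorem zmod_two_cases (x : ZMod 2) : x = 0 ∨ x = 1 := by
  revert x; decide

theorem neg_one_pow_val_add (x y : ZMod 2) :
    (-1 : ℂ) ^ (x + y).val = (-1) ^ x.val * (-1) ^ y.val := by
  obtain rfl | rfl := zmod_two_cases x <;> obtain rfl | rfl := zmod_two_cases y <;>
    simp [ZMod.val_one, show (1 + 1 : ZMod 2) = 0 from rfl]

theorem neg_one_pow_val_mul_self (x : ZMod 2) : (-1 : ℂ) ^ x.val * (-1) ^ x.val = 1 := by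
  rw [← neg_one_pow_val_add, ZModModule.add_self]; simp

theorem neg_one_pow_val_ne_zero (x : ZMod 2) : (-1 : ℂ) ^ x.val ≠ 0 := by
  simp

/-! ### Pauli operators as matrices in the computational basis -/

section Qubits

variable {Q : Type} [Fintype Q] [DecidableEq Q]

theorem mul_pauliX_apply {R : Type*} (B : Matrix R (Q → ZMod 2) ℂ) (a : Q → ZMod 2) (x : R)
    (y : Q → ZMod 2) : (B * pauliX a) x y = B x (y + a) := by
  simp [Matrix.mul_apply, pauliX]

theorem pauliX_mul_apply {R : Type*} (B : Matrix (Q → ZMod 2) R ℂ) (a x : Q → ZMod 2) (y : R) :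
    (pauliX a * B) x y = B (x + a) y := by
  have h : ∀ z : Q → ZMod 2, x = z + a ↔ x + a = z := fun z => by
    constructor <;> rintro rfl <;> rw [add_assoc, ZModModule.add_self, add_zero]
  simp [Matrix.mul_apply, pauliX, h]

theorem mul_pauliZ_apply {R : Type*} (B : Matrix R (Q → ZMod 2) ℂ) (b : Q → ZMod 2) (x : R)
    (y : Q → ZMod 2) : (B * pauliZ b) x y = B x y * (-1 : ℂ) ^ (b ⬝ᵥ y).val := by
  simp [pauliZ]

theorem pauliZ_mul_apply {R : Type*} (B : Matrix (Q → ZMod 2) R ℂ) (b x : Q → ZMod 2) (y : R) :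
    (pauliZ b * B) x y = (-1 : ℂ) ^ (b ⬝ᵥ x).val * B x y := by
  simp [pauliZ]

theorem pauliX_mul_pauliX (a b : Q → ZMod 2) : pauliX a * pauliX b = pauliX (a + b) := by
  ext x y
  simp [mul_pauliX_apply, pauliX, add_assoc, add_comm a b]

theorem pauliZ_mul_pauliZ (a b : Q → ZMod 2) : pauliZ a * pauliZ b = pauliZ (a + b) := by
  simp [pauliZ, add_dotProduct, neg_one_pow_val_add]

theorem pauliX_zero : pauliX (0 : Q → ZMod 2) = 1 := by
  ext x y
  simp [pauliX, Matrix.one_apply]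

theorem pauliZ_zero : pauliZ (0 : Q → ZMod 2) = 1 := by
  simp [pauliZ]

theorem pauliZ_mul_pauliX (a b : Q → ZMod 2) :
    pauliZ b * pauliX a = (-1 : ℂ) ^ (b ⬝ᵥ a).val • (pauliX a * pauliZ b) := by
  ext x y
  simp only [mul_pauliX_apply, Matrix.smul_apply, mul_pauliZ_apply, smul_eq_mul, pauliX]
  simp only [pauliZ, Matrix.diagonal_apply]
  split_ifs with h
  · rw [h, dotProduct_add, neg_one_pow_val_add]; ring
  · simp

theorem pauliX_conjTranspose (a : Q → ZMod 2) : (pauliX a)ᴴ = pauliX a := by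
  ext x y
  have h : y = x + a ↔ x = y + a := by
    constructor <;> rintro rfl <;> rw [add_assoc, ZModModule.add_self, add_zero]
  simp [pauliX, Matrix.conjTranspose_apply, h, apply_ite]

theorem pauliZ_conjTranspose (b : Q → ZMod 2) : (pauliZ b)ᴴ = pauliZ b := by
  simp [pauliZ, Matrix.diagonal_conjTranspose]

theorem pauliX_mul_self (a : Q → ZMod 2) : pauliX a * pauliX a = 1 := by
  rw [pauliX_mul_pauliX, ZModModule.add_self, pauliX_zero]

theorem pauliZ_mul_self (b : Q → ZMod 2) : pauliZ b * pauliZ b = 1 := by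
  rw [pauliZ_mul_pauliZ, ZModModule.add_self, pauliZ_zero]

theorem pauliX_mem_unitaryGroup (a : Q → ZMod 2) :
    pauliX a ∈ Matrix.unitaryGroup (Q → ZMod 2) ℂ := by
  rw [Matrix.mem_unitaryGroup_iff, Matrix.star_eq_conjTranspose, pauliX_conjTranspose,
    pauliX_mul_self]

theorem pauliZ_mem_unitaryGroup (b : Q → ZMod 2) :
    pauliZ b ∈ Matrix.unitaryGroup (Q → ZMod 2) ℂ := by
  rw [Matrix.mem_unitaryGroup_iff, Matrix.star_eq_conjTranspose, pauliZ_conjTranspose,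
    pauliZ_mul_self]

/-! ## Supports -/

/-- The operator `B` commutes with the Pauli operators on the single qubit `q`. -/
def CommutesAt (B : Op Q) (q : Q) : Prop :=
  Commute B (pauliX (Pi.single q 1)) ∧ Commute B (pauliZ (Pi.single q 1))

theorem commute_pauliX_iff (B : Op Q) (a : Q → ZMod 2) :
    Commute B (pauliX a) ↔ ∀ x y, B (x + a) (y + a) = B x y := by
  constructor
  · intro h x y
    have := congr_fun (congr_fun h.eq x) (y + a)
    rw [mul_pauliX_apply, pauliX_mul_apply, add_assoc, ZModModule.add_self, add_zero] at this
    exact this.symm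
  · intro h
    ext x y
    rw [mul_pauliX_apply, pauliX_mul_apply, ← h x (y + a), add_assoc, ZModModule.add_self,
      add_zero]

theorem commute_pauliZ_iff (B : Op Q) (b : Q → ZMod 2) :
    Commute B (pauliZ b) ↔ ∀ x y, B x y ≠ 0 → b ⬝ᵥ x = b ⬝ᵥ y := by
  have key : ∀ u v : ZMod 2, (-1 : ℂ) ^ u.val = (-1) ^ v.val → u = v := by
    intro u v h
    obtain rfl | rfl := zmod_two_cases u <;> obtain rfl | rfl := zmod_two_cases v <;>
      norm_num [ZMod.val_one] at h <;> rfl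
  constructor
  · intro h x y hB
    have := congr_fun (congr_fun h.eq x) y
    rw [mul_pauliZ_apply, pauliZ_mul_apply, mul_comm] at this
    exact key _ _ (mul_right_cancel₀ hB this).symm
  · intro h
    ext x y
    rw [mul_pauliZ_apply, pauliZ_mul_apply]
    by_cases hB : B x y = 0
    · simp [hB]
    · rw [h x y hB, mul_comm]

/-- Commuting with `Z` at `q` kills the entries with `x q ≠ y q`, and commuting with `X` makes the
others independent of the common bit. Commutation is visibly stable under products and adjoints,
unlike the entrywise definition. -/
theorem actsTriviallyAt_iff (B : Op Q) (q : Q) : ActsTriviallyAt B q ↔ CommutesAt B q := by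
  have upd : ∀ x : Q → ZMod 2, ∀ c, x q = c → Function.update x q 0 = x + Pi.single q c := by
    rintro x c rfl
    ext p
    by_cases hp : p = q
    · subst hp; simp [ZModModule.add_self]
    · simp [hp]
  unfold ActsTriviallyAt CommutesAt
  rw [commute_pauliX_iff, commute_pauliZ_iff]
  simp only [single_one_dotProduct]
  constructor
  · intro h
    refine ⟨fun x y => ?_, fun x y hB => ?_⟩
    · rw [h, h x y]
      have e : ∀ x : Q → ZMod 2,
          Function.update (x + Pi.single q 1) q 0 = Function.update x q 0 := by
        intro x; ext p; by_cases hp : p = q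
        · subst hp; simp
        · simp [hp]
      simp [e]
    · by_contra hne
      rw [h, if_neg hne] at hB
      exact hB rfl
  · rintro ⟨h1, h2⟩ x y
    split_ifs with h
    · obtain h0 | h0 := zmod_two_cases (x q)
      · rw [upd x _ h0, upd y _ (h ▸ h0)]; simp
      · rw [upd x _ h0, upd y _ (h ▸ h0), h1]
    · by_contra hB
      exact h (h2 x y hB)

theorem opSupport_subset_iff (B : Op Q) (R : Set Q) :
    opSupport B ⊆ R ↔ ∀ q, q ∉ R → CommutesAt B q := by
  simp only [opSupport, Set.subset_def, Set.mem_ofPred_eq, actsTriviallyAt_iff]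
  exact forall_congr' fun q => not_imp_comm

theorem opSupport_mul_subset {B C : Op Q} {R : Set Q} (hB : opSupport B ⊆ R)
    (hC : opSupport C ⊆ R) : opSupport (B * C) ⊆ R := by
  rw [opSupport_subset_iff] at *
  exact fun q hq => ⟨(hB q hq).1.mul_left (hC q hq).1, (hB q hq).2.mul_left (hC q hq).2⟩

theorem opSupport_conjTranspose_subset {B : Op Q} {R : Set Q} (hB : opSupport B ⊆ R) :
    opSupport Bᴴ ⊆ R := by
  rw [opSupport_subset_iff] at *
  intro q hq
  obtain ⟨h1, h2⟩ := hB q hq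
  constructor
  · have := congrArg Matrix.conjTranspose h1.eq
    rw [Matrix.conjTranspose_mul, Matrix.conjTranspose_mul, pauliX_conjTranspose] at this
    exact this.symm
  · have := congrArg Matrix.conjTranspose h2.eq
    rw [Matrix.conjTranspose_mul, Matrix.conjTranspose_mul, pauliZ_conjTranspose] at this
    exact this.symm

theorem opSupport_pauliX_subset {a : Q → ZMod 2} {R : Set Q} (h : ∀ q, a q ≠ 0 → q ∈ R) :
    opSupport (pauliX a) ⊆ R := by
  rw [opSupport_subset_iff]
  intro q hq
  have ha : a q = 0 := by by_contra hne; exact hq (h q hne)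
  refine ⟨?_, ?_⟩
  · rw [Commute, SemiconjBy, pauliX_mul_pauliX, pauliX_mul_pauliX, add_comm]
  · rw [Commute, SemiconjBy, pauliZ_mul_pauliX]
    simp [ha]

theorem opSupport_pauliZ_subset {b : Q → ZMod 2} {R : Set Q} (h : ∀ q, b q ≠ 0 → q ∈ R) :
    opSupport (pauliZ b) ⊆ R := by
  rw [opSupport_subset_iff]
  intro q hq
  have hb : b q = 0 := by by_contra hne; exact hq (h q hne)
  refine ⟨?_, ?_⟩
  · rw [Commute, SemiconjBy, pauliZ_mul_pauliX]
    simp [hb]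
  · rw [Commute, SemiconjBy, pauliZ_mul_pauliZ, pauliZ_mul_pauliZ, add_comm]

theorem eq_of_apply_ne_zero {B : Op Q} {R : Set Q} (hB : opSupport B ⊆ R) {x y : Q → ZMod 2}
    (h : B x y ≠ 0) {q : Q} (hq : q ∉ R) : x q = y q := by
  have := (commute_pauliZ_iff _ _).1 ((opSupport_subset_iff _ _).1 hB q hq).2 x y h
  simpa using this

/-- The shift by `a` is a product of single-qubit `X` operators off `R`, and `B` commutes with each
of them. -/
theorem apply_add_add {B : Op Q} {R : Set Q} (hB : opSupport B ⊆ R) {a : Q → ZMod 2}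
    (ha : ∀ q ∈ R, a q = 0) (x y : Q → ZMod 2) : B (x + a) (y + a) = B x y := by
  have key : ∀ s : Finset Q, (∀ q ∈ s, q ∉ R) →
      Commute B (pauliX (∑ q ∈ s, Pi.single q (1 : ZMod 2))) := by
    intro s
    induction s using Finset.induction_on with
    | empty => intro; rw [Finset.sum_empty, pauliX_zero]; exact Commute.one_right B
    | insert q s hq ih =>
      intro hs
      rw [Finset.sum_insert hq, ← pauliX_mul_pauliX]
      exact (((opSupport_subset_iff _ _).1 hB q (hs q (by simp))).1).mul_right
        (ih fun p hp => hs p (by simp [hp]))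
  have hsum : ∑ q ∈ Finset.univ.filter (fun q => a q ≠ 0), Pi.single q (1 : ZMod 2) = a := by
    ext p
    rw [Finset.sum_apply]
    simp only [Pi.single_apply, Finset.sum_ite_eq, Finset.mem_filter, Finset.mem_univ, true_and]
    obtain h | h := zmod_two_cases (a p) <;> simp [h]
  have := key (Finset.univ.filter fun q => a q ≠ 0)
    (fun q hq hqR => (Finset.mem_filter.1 hq).2 (ha q hqR))
  rw [hsum] at this
  exact (commute_pauliX_iff _ _).1 this x y

/-- Operators with disjoint supports commute. -/
theorem commute_of_disjoint_support {B Y : Op Q} {R : Set Q} (hB : opSupport B ⊆ R)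
    (hY : opSupport Y ⊆ Rᶜ) : Commute B Y := by
  classical
  -- Only one intermediate string contributes to the product: off `R` the factor `B` forces it to
  -- agree with `x`, and on `R` the factor `Y` forces it to agree with `y`.
  have glue : ∀ B Y : Op Q, ∀ R : Set Q, opSupport B ⊆ R → opSupport Y ⊆ Rᶜ → ∀ x y,
      (B * Y) x y = B x (fun q => if q ∈ R then y q else x q) *
        Y (fun q => if q ∈ R then y q else x q) y := by
    intro B Y R hB hY x y
    rw [Matrix.mul_apply]
    refine Finset.sum_eq_single _ (fun z _ hz => ?_) (by simp)
    by_contra hne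
    obtain ⟨h1, h2⟩ := mul_ne_zero_iff.1 hne
    apply hz
    ext q
    split_ifs with hq
    · exact eq_of_apply_ne_zero hY h2 (by simpa using hq)
    · exact (eq_of_apply_ne_zero hB h1 hq).symm
  ext x y
  rw [glue B Y R hB hY, glue Y B Rᶜ hY (by simpa using hB), mul_comm]
  have tw : ∀ u v : ZMod 2, u + (u + v) = v := fun u v => by
    rw [← add_assoc, ZModModule.add_self, zero_add]
  have tw' : ∀ u v : ZMod 2, v + (u + v) = u := fun u v => by
    rw [add_comm u v, tw]
  congr 1
  · rw [← apply_add_add hY (a := fun q => if q ∈ R then x q + y q else 0)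
      (fun q hq => if_neg hq)]
    congr 1 <;> ext q <;> by_cases hq : q ∈ R <;> simp [hq, tw']
  · rw [← apply_add_add hB (a := fun q => if q ∈ R then 0 else x q + y q)
      (fun q hq => if_pos hq)]
    congr 1 <;> ext q <;> by_cases hq : q ∈ R <;> simp [hq, tw]

/-- An operator with empty support is a scalar. -/
theorem exists_eq_smul_one_of_commutesAt {B : Op Q} (h : ∀ q, CommutesAt B q) :
    ∃ c : ℂ, B = c • 1 := by
  have hB : opSupport B ⊆ ∅ := (opSupport_subset_iff _ _).2 fun q _ => h q
  refine ⟨B 0 0, ?_⟩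
  ext x y
  by_cases hxy : x = y
  · subst hxy
    have := apply_add_add hB (a := x) (by simp) 0 0
    simpa using this
  · rw [Matrix.smul_apply, Matrix.one_apply_ne hxy, smul_zero]
    by_contra hne
    exact hxy (funext fun q => eq_of_apply_ne_zero hB hne (Set.notMem_empty q))

/-! ## The support map -/

theorem subset_supportMap (V : Op Q) (R : Set Q) : R ⊆ supportMap V R :=
  Set.subset_union_left

theorem opSupport_conj_subset_supportMap (V : Op Q) {B : Op Q} {R : Set Q}
    (hB : opSupport B ⊆ R) : opSupport (V * B * Vᴴ) ⊆ supportMap V R :=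
  fun _ hq => Or.inr ⟨B, hB, hq⟩

theorem supportMap_subset {V : Op Q} {R T : Set Q} (hRT : R ⊆ T)
    (h : ∀ B : Op Q, opSupport B ⊆ R → opSupport (V * B * Vᴴ) ⊆ T) : supportMap V R ⊆ T := by
  rintro q (hq | ⟨B, hB, hq⟩)
  exacts [hRT hq, h B hB hq]

theorem supportMap_mono (V : Op Q) {R T : Set Q} (h : R ⊆ T) :
    supportMap V R ⊆ supportMap V T :=
  supportMap_subset (h.trans (subset_supportMap V T)) fun _ hB =>
    opSupport_conj_subset_supportMap V (hB.trans h)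

theorem supportMap_mul_subset (V W : Op Q) (R : Set Q) :
    supportMap (V * W) R ⊆ supportMap V (supportMap W R) := by
  refine supportMap_subset ((subset_supportMap W R).trans (subset_supportMap V _))
    fun B hB => ?_
  have := opSupport_conj_subset_supportMap V (opSupport_conj_subset_supportMap W hB)
  rwa [Matrix.conjTranspose_mul, show V * W * B * (Wᴴ * Vᴴ) = V * (W * B * Wᴴ) * Vᴴ by
    simp only [mul_assoc]]

theorem conjTranspose_mul_self_of_mem {n : Type*} [Fintype n] [DecidableEq n]
    {V : Matrix n n ℂ} (hV : V ∈ Matrix.unitaryGroup n ℂ) : Vᴴ * V = 1 :=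
  Matrix.mem_unitaryGroup_iff'.1 hV

theorem mul_conjTranspose_self_of_mem {n : Type*} [Fintype n] [DecidableEq n]
    {V : Matrix n n ℂ} (hV : V ∈ Matrix.unitaryGroup n ℂ) : V * Vᴴ = 1 :=
  Matrix.mem_unitaryGroup_iff.1 hV

theorem conjTranspose_mem_unitaryGroup {n : Type*} [Fintype n] [DecidableEq n]
    {V : Matrix n n ℂ} (hV : V ∈ Matrix.unitaryGroup n ℂ) : Vᴴ ∈ Matrix.unitaryGroup n ℂ := by
  rw [Matrix.mem_unitaryGroup_iff, Matrix.star_eq_conjTranspose, Matrix.conjTranspose_conjTranspose]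
  exact conjTranspose_mul_self_of_mem hV

theorem commute_conj_iff {n : Type*} [Fintype n] [DecidableEq n] {V : Matrix n n ℂ}
    (hV : V ∈ Matrix.unitaryGroup n ℂ) (B P : Matrix n n ℂ) :
    Commute (V * B * Vᴴ) P ↔ Commute B (Vᴴ * P * V) := by
  have h1 := conjTranspose_mul_self_of_mem hV
  have h2 := mul_conjTranspose_self_of_mem hV
  have c1 : ∀ X, Vᴴ * (V * X) = X := fun X => by rw [← mul_assoc, h1, one_mul]
  have c2 : ∀ X, V * (Vᴴ * X) = X := fun X => by rw [← mul_assoc, h2, one_mul]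
  constructor
  · intro h
    have := congrArg (fun X => Vᴴ * X * V) h.eq
    simp only [mul_assoc, c1, h1, mul_one] at this
    simpa only [Commute, SemiconjBy, mul_assoc] using this
  · intro h
    have := congrArg (fun X => V * X * Vᴴ) h.eq
    simp only [mul_assoc, c2, h2, mul_one] at this
    simpa only [Commute, SemiconjBy, mul_assoc] using this

/-- By duality, without decomposing `B`: for a Pauli `P` at a qubit `q` outside both images, `V† P
V` commutes with the single-qubit Paulis on `R` and on `T`. So its support misses `R ∪ T`, and it
commutes with `B`. -/
theorem supportMap_union_subset {V : Op Q} (hV : V ∈ Matrix.unitaryGroup (Q → ZMod 2) ℂ)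
    (R T : Set Q) : supportMap V (R ∪ T) ⊆ supportMap V R ∪ supportMap V T := by
  refine supportMap_subset (Set.union_subset_union (subset_supportMap V R) (subset_supportMap V T))
    fun B hB => ?_
  rw [opSupport_subset_iff]
  intro q hq
  have key : ∀ P : Op Q, (∀ B' : Op Q, opSupport B' ⊆ R ∨ opSupport B' ⊆ T →
      Commute (V * B' * Vᴴ) P) → Commute (V * B * Vᴴ) P := by
    intro P hP
    rw [commute_conj_iff hV]
    refine commute_of_disjoint_support hB ((opSupport_subset_iff _ _).2 fun p hp => ?_)
    have hp' : ∀ a : Q → ZMod 2, (∀ r, a r ≠ 0 → r = p) →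
        (∀ r, a r ≠ 0 → r ∈ R) ∨ (∀ r, a r ≠ 0 → r ∈ T) := by
      intro a ha
      rw [Set.mem_compl_iff, not_not] at hp
      exact hp.imp (fun h r hr => ha r hr ▸ h) (fun h r hr => ha r hr ▸ h)
    have hs : ∀ r, (Pi.single p 1 : Q → ZMod 2) r ≠ 0 → r = p := fun r hr => by
      by_contra hne; exact hr (Pi.single_eq_of_ne hne _)
    refine ⟨((commute_conj_iff hV _ _).1 (hP _ ?_)).symm,
      ((commute_conj_iff hV _ _).1 (hP _ ?_)).symm⟩
    · exact (hp' _ hs).imp opSupport_pauliX_subset opSupport_pauliX_subset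
    · exact (hp' _ hs).imp opSupport_pauliZ_subset opSupport_pauliZ_subset
  have hc : ∀ B' : Op Q, opSupport B' ⊆ R ∨ opSupport B' ⊆ T → CommutesAt (V * B' * Vᴴ) q := by
    rintro B' (h | h)
    · exact (opSupport_subset_iff _ _).1 (opSupport_conj_subset_supportMap V h) q
        fun h' => hq (Or.inl h')
    · exact (opSupport_subset_iff _ _).1 (opSupport_conj_subset_supportMap V h) q
        fun h' => hq (Or.inr h')
  exact ⟨key _ fun B' h => (hc B' h).1, key _ fun B' h => (hc B' h).2⟩

theorem supportMap_empty {V : Op Q} (hV : V ∈ Matrix.unitaryGroup (Q → ZMod 2) ℂ) :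
    supportMap V ∅ = ∅ := by
  refine Set.subset_empty_iff.1 (supportMap_subset subset_rfl fun B hB => ?_)
  obtain ⟨c, rfl⟩ := exists_eq_smul_one_of_commutesAt
    fun q => (opSupport_subset_iff _ _).1 hB q (Set.notMem_empty q)
  rw [mul_smul_comm, mul_one, smul_mul_assoc, mul_conjTranspose_self_of_mem hV]
  exact hB

end Qubits

section Paulis

variable {Q : Type} [Fintype Q] [DecidableEq Q]

/-! ## General Pauli operators -/

/-- The Pauli operator `X ^ a Z ^ b`. -/
def pauli (a b : Q → ZMod 2) : Op Q := pauliX a * pauliZ b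

theorem pauli_mem_unitaryGroup (a b : Q → ZMod 2) :
    pauli a b ∈ Matrix.unitaryGroup (Q → ZMod 2) ℂ :=
  mul_mem (pauliX_mem_unitaryGroup a) (pauliZ_mem_unitaryGroup b)

theorem pauliX_mul_pauli (a b c : Q → ZMod 2) :
    pauliX c * pauli a b = (-1 : ℂ) ^ (b ⬝ᵥ c).val • (pauli a b * pauliX c) := by
  rw [pauli, mul_assoc (pauliX a), pauliZ_mul_pauliX, mul_smul_comm, smul_smul,
    neg_one_pow_val_mul_self, one_smul, ← mul_assoc, ← mul_assoc, pauliX_mul_pauliX,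
    pauliX_mul_pauliX, add_comm]

theorem pauliZ_mul_pauli (a b c : Q → ZMod 2) :
    pauliZ c * pauli a b = (-1 : ℂ) ^ (c ⬝ᵥ a).val • (pauli a b * pauliZ c) := by
  rw [pauli, ← mul_assoc, pauliZ_mul_pauliX, smul_mul_assoc, mul_assoc, mul_assoc,
    pauliZ_mul_pauliZ, pauliZ_mul_pauliZ, add_comm]

theorem pauli_mul_self (a b : Q → ZMod 2) :
    pauli a b * pauli a b = (-1 : ℂ) ^ (b ⬝ᵥ a).val • 1 := by
  nth_rw 1 [pauli]
  rw [mul_assoc, pauliZ_mul_pauli, mul_smul_comm, pauli, mul_assoc, pauliZ_mul_self, mul_one,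
    pauliX_mul_self]

theorem pauli_mul_pauli (a b a' b' : Q → ZMod 2) :
    pauli a b * pauli a' b' = (-1 : ℂ) ^ (b ⬝ᵥ a').val • pauli (a + a') (b + b') := by
  nth_rw 1 [pauli]
  rw [mul_assoc, pauliZ_mul_pauli, mul_smul_comm, pauli, pauli, mul_assoc (pauliX a'),
    pauliZ_mul_pauliZ, ← mul_assoc, pauliX_mul_pauliX, add_comm b']

theorem opSupport_pauli_subset {a b : Q → ZMod 2} {R : Set Q} (ha : ∀ q, a q ≠ 0 → q ∈ R)
    (hb : ∀ q, b q ≠ 0 → q ∈ R) : opSupport (pauli a b) ⊆ R :=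
  opSupport_mul_subset (opSupport_pauliX_subset ha) (opSupport_pauliZ_subset hb)

theorem commute_conj_of_mul_eq_smul {n : Type*} [Fintype n] [DecidableEq n]
    {P B X : Matrix n n ℂ} {s : ℂ} (hP : P ∈ Matrix.unitaryGroup n ℂ) (hs : s ≠ 0)
    (h : X * P = s • (P * X)) (hB : Commute B X) :
    Commute (P * B * Pᴴ) X ∧ Commute (Pᴴ * B * P) X := by
  have h1 := conjTranspose_mul_self_of_mem hP
  have h2 := mul_conjTranspose_self_of_mem hP
  constructor
  · rw [commute_conj_iff hP, mul_assoc, h, mul_smul_comm, ← mul_assoc, h1, one_mul]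
    exact hB.smul_right s
  · have := commute_conj_iff (conjTranspose_mem_unitaryGroup hP) B X
    rw [Matrix.conjTranspose_conjTranspose] at this
    have h' : P * X * Pᴴ = s⁻¹ • X := by
      rw [eq_inv_smul_iff₀ hs, ← smul_mul_assoc, ← h, mul_assoc, h2, mul_one]
    rw [this, h']
    exact hB.smul_right _

/-- Conjugation by a Pauli operator only changes the signs of single-qubit Paulis, so commutation
with them is kept. -/
theorem supportMap_pauli_subset (a b : Q → ZMod 2) (R : Set Q) :
    supportMap (pauli a b) R ⊆ R := by
  refine supportMap_subset subset_rfl fun B hB => ?_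
  rw [opSupport_subset_iff] at *
  exact fun q hq =>
    ⟨(commute_conj_of_mul_eq_smul (pauli_mem_unitaryGroup a b) (neg_one_pow_val_ne_zero _)
      (pauliX_mul_pauli a b _) (hB q hq).1).1,
    (commute_conj_of_mul_eq_smul (pauli_mem_unitaryGroup a b) (neg_one_pow_val_ne_zero _)
      (pauliZ_mul_pauli a b _) (hB q hq).2).1⟩

theorem supportMap_pauli_conjTranspose_subset (a b : Q → ZMod 2) (R : Set Q) :
    supportMap (pauli a b)ᴴ R ⊆ R := by
  refine supportMap_subset subset_rfl fun B hB => ?_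
  rw [Matrix.conjTranspose_conjTranspose]
  rw [opSupport_subset_iff] at *
  exact fun q hq =>
    ⟨(commute_conj_of_mul_eq_smul (pauli_mem_unitaryGroup a b) (neg_one_pow_val_ne_zero _)
      (pauliX_mul_pauli a b _) (hB q hq).1).2,
    (commute_conj_of_mul_eq_smul (pauli_mem_unitaryGroup a b) (neg_one_pow_val_ne_zero _)
      (pauliZ_mul_pauli a b _) (hB q hq).2).2⟩

/-- The group commutator of `V` and the Pauli operator `X ^ a Z ^ b`. -/
def pauliCommutator (V : Op Q) (a b : Q → ZMod 2) : Op Q :=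
  V * pauli a b * Vᴴ * (pauli a b)ᴴ

theorem pauliCommutator_conjTranspose (V : Op Q) (a b : Q → ZMod 2) :
    (pauliCommutator V a b)ᴴ = pauli a b * (V * (pauli a b)ᴴ * Vᴴ) := by
  simp [pauliCommutator, Matrix.conjTranspose_mul, mul_assoc]

/-- The Pauli factors spread nothing, so only `V†` followed by `V` counts. -/
theorem supportMap_pauliCommutator_subset (V : Op Q) (a b : Q → ZMod 2) (R : Set Q) :
    supportMap (pauliCommutator V a b) R ⊆ supportMap V (supportMap Vᴴ R) := by
  unfold pauliCommutator
  refine (supportMap_mul_subset _ _ _).trans ((supportMap_mul_subset _ _ _).trans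
    ((supportMap_mul_subset _ _ _).trans (supportMap_mono _ ?_)))
  exact (supportMap_pauli_subset _ _ _).trans
    (supportMap_mono _ (supportMap_pauli_conjTranspose_subset _ _ _))

theorem supportMap_pauliCommutator_conjTranspose_subset (V : Op Q) (a b : Q → ZMod 2)
    (R : Set Q) :
    supportMap (pauliCommutator V a b)ᴴ R ⊆ supportMap V (supportMap Vᴴ R) := by
  rw [pauliCommutator_conjTranspose]
  refine (supportMap_mul_subset _ _ _).trans ((supportMap_pauli_subset _ _ _).trans
    ((supportMap_mul_subset _ _ _).trans ((supportMap_mul_subset _ _ _).trans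
      (supportMap_mono _ ?_))))
  exact supportMap_pauli_conjTranspose_subset _ _ _

/-- The commutator of `V` with a Pauli operator is supported on the image under the support map
of the part of the Pauli operator inside the support of `V`. -/
theorem opSupport_pauliCommutator_subset (V : Op Q) {a b : Q → ZMod 2} {R : Set Q}
    (ha : ∀ q, a q ≠ 0 → q ∈ R) (hb : ∀ q, b q ≠ 0 → q ∈ R) :
    opSupport (pauliCommutator V a b) ⊆ supportMap V (opSupport V ∩ R) := by
  classical
  set T := opSupport V
  set a₁ : Q → ZMod 2 := fun q => if q ∈ T then a q else 0 with ha₁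
  set a₂ : Q → ZMod 2 := fun q => if q ∈ T then 0 else a q with ha₂
  set b₁ : Q → ZMod 2 := fun q => if q ∈ T then b q else 0 with hb₁
  set b₂ : Q → ZMod 2 := fun q => if q ∈ T then 0 else b q with hb₂
  have in₁ : ∀ c : Q → ZMod 2, ∀ q, (if q ∈ T then c q else 0) ≠ 0 → q ∈ T :=
    fun c q h => by by_contra hq; exact h (if_neg hq)
  have in₂ : ∀ c : Q → ZMod 2, ∀ q, (if q ∈ T then 0 else c q) ≠ 0 → q ∈ Tᶜ :=
    fun c q h hq => h (if_pos hq)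
  have inR : ∀ c : Q → ZMod 2, (∀ q, c q ≠ 0 → q ∈ R) →
      ∀ q, (if q ∈ T then c q else 0) ≠ 0 → q ∈ T ∩ R :=
    fun c hc q h => ⟨in₁ c q h, hc q (by rwa [if_pos (in₁ c q h)] at h)⟩
  have hsum : ∀ c : Q → ZMod 2,
      c = (fun q => if q ∈ T then c q else 0) + fun q => if q ∈ T then 0 else c q := by
    intro c; ext q; by_cases hq : q ∈ T <;> simp [hq]
  -- The Pauli splits into its parts inside and outside the support of `V`; no sign arises because
  -- these are disjoint.
  have hP : pauli a b = pauli a₁ b₁ * pauli a₂ b₂ := by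
    have h0 : b₁ ⬝ᵥ a₂ = 0 := Finset.sum_eq_zero fun q _ => by
      by_cases hq : q ∈ T <;> simp [hb₁, ha₂, hq]
    rw [pauli_mul_pauli, h0, ← hsum a, ← hsum b]
    simp
  have h₁ : opSupport (pauli a₁ b₁) ⊆ T := opSupport_pauli_subset (in₁ a) (in₁ b)
  have h₂ : opSupport (pauli a₂ b₂) ⊆ Tᶜ := opSupport_pauli_subset (in₂ a) (in₂ b)
  have hc : Commute Vᴴ (pauli a₂ b₂) :=
    commute_of_disjoint_support (opSupport_conjTranspose_subset subset_rfl) h₂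
  -- The outer part commutes with `V†` and cancels against its own adjoint.
  have hK : pauliCommutator V a b = V * pauli a₁ b₁ * Vᴴ * (pauli a₁ b₁)ᴴ := by
    rw [pauliCommutator, hP, Matrix.conjTranspose_mul]
    calc V * (pauli a₁ b₁ * pauli a₂ b₂) * Vᴴ * ((pauli a₂ b₂)ᴴ * (pauli a₁ b₁)ᴴ)
        = V * pauli a₁ b₁ * (pauli a₂ b₂ * Vᴴ) * (pauli a₂ b₂)ᴴ * (pauli a₁ b₁)ᴴ := by
          simp only [mul_assoc]
      _ = V * pauli a₁ b₁ * Vᴴ * (pauli a₂ b₂ * (pauli a₂ b₂)ᴴ) * (pauli a₁ b₁)ᴴ := by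
          rw [← hc.eq]; simp only [mul_assoc]
      _ = _ := by
          rw [mul_conjTranspose_self_of_mem (pauli_mem_unitaryGroup _ _), mul_one]
  rw [hK]
  have hin : opSupport (pauli a₁ b₁) ⊆ T ∩ R :=
    opSupport_pauli_subset (inR a ha) (inR b hb)
  exact opSupport_mul_subset (opSupport_conj_subset_supportMap V hin)
    (opSupport_conjTranspose_subset (hin.trans (subset_supportMap _ _)))

/-! ## The Clifford hierarchy up to phases -/

/-- The levels of the Clifford hierarchy with arbitrary phases: level `0` consists of the scalars,
and level `s + 1` of the unitaries whose commutators with Pauli operators are in level `s`. -/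
def projLevel (Q : Type) [Fintype Q] [DecidableEq Q] : ℕ → Set (Op Q)
  | 0 => {V | ∃ c : ℂ, V = c • (1 : Op Q)}
  | s + 1 => {V | V ∈ Matrix.unitaryGroup (Q → ZMod 2) ℂ ∧
      ∀ a b, pauliCommutator V a b ∈ projLevel Q s}

theorem mul_eq_smul_of_commutator_eq_smul {n : Type*} [Fintype n] [DecidableEq n]
    {V P : Matrix n n ℂ} (hV : V ∈ Matrix.unitaryGroup n ℂ) (hP : P ∈ Matrix.unitaryGroup n ℂ)
    {c : ℂ} (h : V * P * Vᴴ * Pᴴ = c • 1) : V * P = c • (P * V) := by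
  calc V * P = V * P * Vᴴ * Pᴴ * (P * V) := by
        rw [mul_assoc _ Pᴴ, ← mul_assoc Pᴴ, conjTranspose_mul_self_of_mem hP, one_mul,
          mul_assoc _ Vᴴ, conjTranspose_mul_self_of_mem hV, mul_one]
    _ = c • (P * V) := by rw [h, smul_mul_assoc, one_mul]

theorem exists_sign_of_mul_eq_smul {n : Type*} [Fintype n] [DecidableEq n] [Nonempty n]
    {V P : Matrix n n ℂ} (hV : V ∈ Matrix.unitaryGroup n ℂ) (hP : P * P = 1) {c : ℂ}
    (h : V * P = c • (P * V)) : ∃ e : ZMod 2, V * P = (-1 : ℂ) ^ e.val • (P * V) := by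
  have h2 : V = (c * c) • V := by
    calc V = V * P * P := by rw [mul_assoc, hP, mul_one]
      _ = (c * c) • (P * P * V) := by
        rw [h, smul_mul_assoc, mul_assoc, h, mul_smul_comm, smul_smul, mul_assoc]
      _ = _ := by rw [hP, one_mul]
  have hc : c * c = 1 := by
    have h3 : (1 : Matrix n n ℂ) = (c * c) • 1 := by
      rw [← mul_conjTranspose_self_of_mem hV, ← smul_mul_assoc, ← h2]
    have i : n := Classical.arbitrary n
    have := congr_fun (congr_fun h3 i) i
    simpa using this.symm
  rcases mul_self_eq_one_iff.1 hc with rfl | rfl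
  · exact ⟨0, by simpa using h⟩
  · exact ⟨1, by simpa [ZMod.val_one] using h⟩

/-- A unitary that commutes with all Pauli operators up to phases is a Pauli operator up to a
phase. -/
theorem exists_eq_smul_pauli_of_mem_projLevel_one {V : Op Q} (h : V ∈ projLevel Q 1) :
    ∃ (c : ℂ) (a b : Q → ZMod 2), V = c • pauli a b := by
  obtain ⟨hV, h⟩ := h
  have hX : ∀ q, ∃ e : ZMod 2, V * pauliX (Pi.single q 1) =
      (-1 : ℂ) ^ e.val • (pauliX (Pi.single q 1) * V) := fun q => by
    obtain ⟨c, hc⟩ := h (Pi.single q 1) 0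
    have := mul_eq_smul_of_commutator_eq_smul hV (pauli_mem_unitaryGroup _ _) hc
    rw [pauli, pauliZ_zero, mul_one] at this
    exact exists_sign_of_mul_eq_smul hV (pauliX_mul_self _) this
  have hZ : ∀ q, ∃ e : ZMod 2, V * pauliZ (Pi.single q 1) =
      (-1 : ℂ) ^ e.val • (pauliZ (Pi.single q 1) * V) := fun q => by
    obtain ⟨c, hc⟩ := h 0 (Pi.single q 1)
    have := mul_eq_smul_of_commutator_eq_smul hV (pauli_mem_unitaryGroup _ _) hc
    rw [pauli, pauliX_zero, one_mul] at this
    exact exists_sign_of_mul_eq_smul hV (pauliZ_mul_self _) this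
  choose b hb using hX
  choose a ha using hZ
  -- The signs against the `X`'s give the `Z`-part `b`, and the signs against the `Z`'s the `X`-part
  -- `a`. Dividing `V` by `pauli a b` leaves an operator commuting with every single-qubit Pauli,
  -- hence a scalar.
  have key : ∀ {P X : Op Q} {e : ZMod 2}, P * Pᴴ = 1 → Pᴴ * P = 1 →
      X * P = (-1 : ℂ) ^ e.val • (P * X) → V * X = (-1 : ℂ) ^ e.val • (X * V) →
      Commute (Pᴴ * V) X := by
    intro P X e hP hP' h1 h2
    have h3 : Pᴴ * X = (-1 : ℂ) ^ e.val • (X * Pᴴ) := by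
      calc Pᴴ * X = Pᴴ * (X * P) * Pᴴ := by rw [mul_assoc, mul_assoc, hP, mul_one]
        _ = _ := by rw [h1, mul_smul_comm, smul_mul_assoc, ← mul_assoc, hP', one_mul]
    rw [Commute, SemiconjBy, mul_assoc, h2, mul_smul_comm, ← mul_assoc, h3, smul_mul_assoc,
      smul_smul, neg_one_pow_val_mul_self, one_smul, mul_assoc]
  obtain ⟨c, hc⟩ := exists_eq_smul_one_of_commutesAt (B := (pauli a b)ᴴ * V) fun q =>
    ⟨key (mul_conjTranspose_self_of_mem (pauli_mem_unitaryGroup _ _))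
      (conjTranspose_mul_self_of_mem (pauli_mem_unitaryGroup _ _))
      (pauliX_mul_pauli a b _) (by simpa using hb q),
    key (mul_conjTranspose_self_of_mem (pauli_mem_unitaryGroup _ _))
      (conjTranspose_mul_self_of_mem (pauli_mem_unitaryGroup _ _))
      (pauliZ_mul_pauli a b _) (by simpa using ha q)⟩
  refine ⟨c, a, b, ?_⟩
  rw [← mul_one (pauli a b), ← mul_smul_comm, ← hc, ← mul_assoc,
    mul_conjTranspose_self_of_mem (pauli_mem_unitaryGroup _ _), one_mul]

theorem exists_eq_I_pow_of_mul_self {c : ℂ} (h : c * c = 1 ∨ c * c = -1) :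
    ∃ s : ℕ, c = Complex.I ^ s := by
  rcases h with h | h
  · rcases mul_self_eq_one_iff.1 h with rfl | rfl
    exacts [⟨0, by simp⟩, ⟨2, by simp⟩]
  · have : (c - Complex.I) * (c + Complex.I) = 0 := by
      linear_combination h - Complex.I_mul_I
    rcases mul_eq_zero.1 this with h | h
    · exact ⟨1, by rw [pow_one]; exact sub_eq_zero.1 h⟩
    · refine ⟨3, ?_⟩
      rw [Complex.I_pow_three]; exact eq_neg_of_add_eq_zero_left h

theorem neg_one_pow_val_eq (e : ZMod 2) : (-1 : ℂ) ^ e.val = 1 ∨ (-1 : ℂ) ^ e.val = -1 :=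
  neg_one_pow_eq_or ℂ e.val

/-- The conjugate of a Pauli has the same square `±1` as the Pauli itself. Being `±c` times a Pauli,
whose square is also `±1`, it forces `c * c = ±1`. -/
theorem pauliCommutator_mem_pauliGroup {V : Op Q} (hV : V ∈ Matrix.unitaryGroup (Q → ZMod 2) ℂ)
    {a b : Q → ZMod 2} (h : pauliCommutator V a b ∈ projLevel Q 1) :
    pauliCommutator V a b ∈ pauliGroup Q := by
  obtain ⟨c, a', b', hc⟩ := exists_eq_smul_pauli_of_mem_projLevel_one h
  suffices hs : c * c = 1 ∨ c * c = -1 by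
    obtain ⟨s, hs⟩ := exists_eq_I_pow_of_mul_self hs
    exact ⟨s, a', b', by rw [hc, hs, pauli]⟩
  obtain ⟨e₁, h₁⟩ : ∃ e : ZMod 2, pauli a' b' * pauli a b =
      (-1 : ℂ) ^ e.val • pauli (a' + a) (b' + b) := ⟨_, pauli_mul_pauli _ _ _ _⟩
  obtain ⟨e₂, h₂⟩ : ∃ e : ZMod 2, pauli (a' + a) (b' + b) * pauli (a' + a) (b' + b) =
      (-1 : ℂ) ^ e.val • 1 := ⟨_, pauli_mul_self _ _⟩
  have h3 : V * pauli a b * Vᴴ = (c * (-1 : ℂ) ^ e₁.val) • pauli (a' + a) (b' + b) := by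
    rw [mul_smul, ← h₁, ← smul_mul_assoc, ← hc, pauliCommutator, mul_assoc _ (pauli a b)ᴴ,
      conjTranspose_mul_self_of_mem (pauli_mem_unitaryGroup _ _), mul_one]
  have h4 : (V * pauli a b * Vᴴ) * (V * pauli a b * Vᴴ) = (-1 : ℂ) ^ (b ⬝ᵥ a).val • 1 := by
    calc (V * pauli a b * Vᴴ) * (V * pauli a b * Vᴴ)
        = V * pauli a b * (Vᴴ * V) * (pauli a b * Vᴴ) := by simp only [mul_assoc]
      _ = V * (pauli a b * pauli a b) * Vᴴ := by
        rw [conjTranspose_mul_self_of_mem hV, mul_one]; simp only [mul_assoc]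
      _ = _ := by
        rw [pauli_mul_self, mul_smul_comm, mul_one, smul_mul_assoc,
          mul_conjTranspose_self_of_mem hV]
  rw [h3, smul_mul_smul_comm, h₂, smul_smul] at h4
  have h5 := congr_fun (congr_fun h4 0) 0
  simp only [Matrix.smul_apply, Matrix.one_apply_eq, smul_eq_mul, mul_one] at h5
  have h6 := neg_one_pow_val_mul_self e₁
  rcases neg_one_pow_val_eq e₂ with h7 | h7 <;>
    rcases neg_one_pow_val_eq (b ⬝ᵥ a) with h8 | h8 <;> rw [h7, h8] at h5
  · left; linear_combination h5 - c * c * h6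
  · right; linear_combination h5 - c * c * h6
  · right; linear_combination -h5 - c * c * h6
  · left; linear_combination -h5 - c * c * h6

/-- Phases of Paulis cancel in commutators. The start is level two because level one of `projLevel`
allows any unit scalar times a Pauli, whereas a commutator with a Pauli has its phase restricted. -/
theorem projLevel_add_two_subset (s : ℕ) : projLevel Q (s + 2) ⊆ cliffordHierarchy Q (s + 2) := by
  have comm : ∀ (V P : Op Q) (n : ℕ), V * (Complex.I ^ n • P) * Vᴴ * (Complex.I ^ n • P)ᴴ =
      V * P * Vᴴ * Pᴴ := by
    intro V P n
    simp only [Matrix.conjTranspose_smul, mul_smul_comm, smul_mul_assoc, smul_smul]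
    simp [← mul_pow]
  induction s with
  | zero =>
    rintro V ⟨hV, h⟩
    refine ⟨hV, ?_⟩
    rintro _ ⟨n, a, b, rfl⟩
    rw [comm]
    exact pauliCommutator_mem_pauliGroup hV (h a b)
  | succ s ih =>
    rintro V ⟨hV, h⟩
    refine ⟨hV, ?_⟩
    rintro _ ⟨n, a, b, rfl⟩
    rw [comm]
    exact ih (h a b)

end Paulis

section Encoding

variable {Q : Type} [Fintype Q] [DecidableEq Q]

/-! ## Encoded gates -/

/-- `V` acts as `W` on the space encoded by `E`, and so does `V†` as `W†`. -/
def Implements {n m : Type*} [Fintype n] [DecidableEq n] [Fintype m] [DecidableEq m]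
    (E : Matrix n m ℂ) (V : Matrix n n ℂ) (W : Matrix m m ℂ) : Prop :=
  V ∈ Matrix.unitaryGroup n ℂ ∧ V * E = E * W ∧ Vᴴ * E = E * Wᴴ

section

variable {n m : Type*} [Fintype n] [DecidableEq n] [Fintype m] [DecidableEq m]
  {E : Matrix n m ℂ} {V V' : Matrix n n ℂ} {W W' : Matrix m m ℂ}

theorem Implements.mul (h : Implements E V W) (h' : Implements E V' W') :
    Implements E (V * V') (W * W') := by
  refine ⟨mul_mem h.1 h'.1, ?_, ?_⟩
  · rw [Matrix.mul_assoc, h'.2.1, ← Matrix.mul_assoc, h.2.1, Matrix.mul_assoc]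
  · rw [Matrix.conjTranspose_mul, Matrix.conjTranspose_mul, Matrix.mul_assoc, h.2.2,
      ← Matrix.mul_assoc, h'.2.2, Matrix.mul_assoc]

theorem Implements.conjTranspose (h : Implements E V W) : Implements E Vᴴ Wᴴ :=
  ⟨conjTranspose_mem_unitaryGroup h.1, h.2.2, by
    rw [Matrix.conjTranspose_conjTranspose, Matrix.conjTranspose_conjTranspose]; exact h.2.1⟩

theorem cancel_isometry (hE : Eᴴ * E = 1) {X Y : Matrix m m ℂ} (h : E * X = E * Y) : X = Y := by
  rw [← Matrix.one_mul X, ← Matrix.one_mul Y, ← hE, Matrix.mul_assoc, h, Matrix.mul_assoc]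

theorem Implements.mem_unitaryGroup (hE : Eᴴ * E = 1) (h : Implements E V W) :
    W ∈ Matrix.unitaryGroup m ℂ := by
  rw [Matrix.mem_unitaryGroup_iff, Matrix.star_eq_conjTranspose]
  refine cancel_isometry hE ?_
  rw [← (h.mul h.conjTranspose).2.1, mul_conjTranspose_self_of_mem h.1, Matrix.one_mul,
    Matrix.mul_one]

/-- This allows a logical operator to be replaced by whichever physical representative has disjoint
support. -/
theorem Implements.commute (hE : Eᴴ * E = 1) (h : Implements E V W) (h' : Implements E V' W')
    (hc : Commute V V') : Commute W W' := by
  refine cancel_isometry hE ?_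
  rw [← (h.mul h').2.1, ← (h'.mul h).2.1, hc.eq]

end

variable {SX SZ : Submodule (ZMod 2) (Q → ZMod 2)} {k : ℕ} {L : Fin k → Q → ZMod 2}

theorem sum_smul_add (L : Fin k → Q → ZMod 2) (a b : Fin k → ZMod 2) :
    ∑ i, (a + b) i • L i = ∑ i, a i • L i + ∑ i, b i • L i := by
  simp [add_smul, Finset.sum_add_distrib]

theorem IsLogicalBasis.dotProduct_sum_smul (hL : IsLogicalBasis SX SZ L) {b : Q → ZMod 2}
    (hb : b ∈ SZ) (a : Fin k → ZMod 2) : b ⬝ᵥ ∑ i, a i • L i = 0 := by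
  simp [dotProduct_sum, hL.1 _ b hb]

theorem IsLogicalBasis.eq_of_sub_mem (hL : IsLogicalBasis SX SZ L) {x : Q → ZMod 2}
    {a b : Fin k → ZMod 2} (ha : x - ∑ i, a i • L i ∈ SX) (hb : x - ∑ i, b i • L i ∈ SX) :
    a = b := by
  have h0 : (0 : Q → ZMod 2) - ∑ i, (a + b) i • L i ∈ SX := by
    have := SX.sub_mem ha hb
    have e : (0 : Q → ZMod 2) - ∑ i, (a + b) i • L i =
        x - ∑ i, a i • L i - (x - ∑ i, b i • L i) := by
      rw [sum_smul_add]
      simp only [ZModModule.sub_eq_add]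
      rw [add_add_add_comm, ZModModule.add_self]
    rwa [e]
  have h1 : (0 : Q → ZMod 2) - ∑ i, (0 : Fin k → ZMod 2) i • L i ∈ SX := by simp
  have := (hL.2 0 (fun b _ => dotProduct_zero b)).unique h0 h1
  rw [← ZModModule.sub_eq_add] at this
  exact sub_eq_zero.1 this

open Classical in
theorem encoder_apply (SX : Submodule (ZMod 2) (Q → ZMod 2)) (L : Fin k → Q → ZMod 2)
    (x : Q → ZMod 2) (a : Fin k → ZMod 2) : encoder SX L x a =
      if x - ∑ i, a i • L i ∈ SX then (((Real.sqrt (Nat.card SX))⁻¹ : ℝ) : ℂ) else 0 := rfl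

/-- The columns are normalized uniform superpositions over cosets of `SX`, and distinct labels give
disjoint cosets. -/
theorem encoder_isometry (hL : IsLogicalBasis SX SZ L) : (encoder SX L)ᴴ * encoder SX L = 1 := by
  classical
  ext a b
  rw [Matrix.mul_apply, Matrix.one_apply]
  simp only [Matrix.conjTranspose_apply, encoder_apply]
  split_ifs with hab
  · subst hab
    have h1 : ∀ x : Q → ZMod 2, star (if x - ∑ i, a i • L i ∈ SX then
        (((Real.sqrt (Nat.card SX))⁻¹ : ℝ) : ℂ) else 0) *
        (if x - ∑ i, a i • L i ∈ SX then (((Real.sqrt (Nat.card SX))⁻¹ : ℝ) : ℂ) else 0) =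
        if x - ∑ i, a i • L i ∈ SX then ((Nat.card SX : ℂ))⁻¹ else 0 := by
      intro x
      split_ifs
      · rw [Complex.star_def, Complex.conj_ofReal, ← Complex.ofReal_mul, ← mul_inv,
          Real.mul_self_sqrt (Nat.cast_nonneg _)]
        simp
      · simp
    rw [Finset.sum_congr rfl fun x _ => h1 x, ← Finset.sum_filter, Finset.sum_const,
      nsmul_eq_mul]
    have hcard : (Finset.univ.filter fun x => x - ∑ i, a i • L i ∈ SX).card = Nat.card SX := by
      rw [← Fintype.card_subtype, ← Nat.card_eq_fintype_card]
      exact Nat.card_congr ((Equiv.subRight (∑ i, a i • L i)).subtypeEquiv fun x => Iff.rfl)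
    rw [hcard]
    exact mul_inv_cancel₀ (Nat.cast_ne_zero.2 (Nat.card_pos).ne')
  · refine Finset.sum_eq_zero fun x _ => ?_
    by_cases h1 : x - ∑ i, a i • L i ∈ SX
    · rw [if_neg fun h2 => hab (hL.eq_of_sub_mem h1 h2), mul_zero]
    · rw [if_neg h1, star_zero, zero_mul]

theorem encoder_mul_mem_codeSpace (hXZ : ∀ s ∈ SX, ∀ b ∈ SZ, b ⬝ᵥ s = 0)
    (hL : IsLogicalBasis SX SZ L) (φ : (Fin k → ZMod 2) → ℂ) :
    encoder SX L *ᵥ φ ∈ codeSpace SX SZ := by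
  classical
  constructor
  · intro s hs
    rw [Matrix.mulVec_mulVec]
    congr 1
    ext x a
    rw [pauliX_mul_apply, encoder_apply, encoder_apply, add_sub_right_comm]
    simp only [SX.add_mem_iff_left hs]
  · intro b hb
    rw [Matrix.mulVec_mulVec]
    congr 1
    ext x a
    rw [pauliZ_mul_apply, encoder_apply]
    split_ifs with h
    · have : b ⬝ᵥ x = 0 := by
        rw [← sub_add_cancel x (∑ i, a i • L i), dotProduct_add, hXZ _ h b hb,
          hL.dotProduct_sum_smul hb, add_zero]
      simp [this]
    · simp

/-- `X`-stabilizers make `ψ` constant on cosets of `SX`, and `Z`-stabilizers confine it to the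
strings orthogonal to `SZ`. The cosets of such strings are exactly those labelled by `L`. -/
theorem exists_eq_encoder_mulVec (hXZ : ∀ s ∈ SX, ∀ b ∈ SZ, b ⬝ᵥ s = 0)
    (hL : IsLogicalBasis SX SZ L) {ψ : (Q → ZMod 2) → ℂ} (hψ : ψ ∈ codeSpace SX SZ) :
    ∃ φ, ψ = encoder SX L *ᵥ φ := by
  classical
  obtain ⟨hX, hZ⟩ := hψ
  have hX' : ∀ s ∈ SX, ∀ x, ψ (x + s) = ψ x := by
    intro s hs x
    have := congr_fun (hX s hs) x
    rw [← this]
    have h2 := pauliX_mul_apply (Matrix.replicateCol Unit ψ) s x ()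
    rw [Matrix.mul_apply] at h2
    exact h2.symm
  have hZ' : ∀ b ∈ SZ, ∀ x, ψ x ≠ 0 → b ⬝ᵥ x = 0 := by
    intro b hb x hx
    have := congr_fun (hZ b hb) x
    rw [pauliZ, Matrix.mulVec_diagonal] at this
    obtain h | h := zmod_two_cases (b ⬝ᵥ x)
    · exact h
    · rw [h, ZMod.val_one, pow_one, neg_one_mul] at this
      exact absurd (self_eq_neg.1 this.symm) hx
  have hc : (((Real.sqrt (Nat.card SX))⁻¹ : ℝ) : ℂ) ≠ 0 := by
    rw [Complex.ofReal_ne_zero]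
    exact inv_ne_zero (Real.sqrt_ne_zero'.2 (Nat.cast_pos.2 Nat.card_pos))
  refine ⟨fun a => (((Real.sqrt (Nat.card SX))⁻¹ : ℝ) : ℂ)⁻¹ * ψ (∑ i, a i • L i), ?_⟩
  ext x
  rw [Matrix.mulVec, dotProduct]
  by_cases hx : ∀ b ∈ SZ, b ⬝ᵥ x = 0
  · obtain ⟨a, ha, -⟩ := hL.2 x hx
    rw [Finset.sum_eq_single a]
    · rw [encoder_apply, if_pos ha, mul_inv_cancel_left₀ hc, ← hX' _ ha (∑ i, a i • L i),
        add_sub_cancel]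
    · intro b _ hb
      rw [encoder_apply, if_neg fun h => hb (hL.eq_of_sub_mem h ha), zero_mul]
    · simp
  · have h0 : ψ x = 0 := by
      by_contra hne
      exact hx fun b hb => hZ' b hb x hne
    rw [h0]
    refine (Finset.sum_eq_zero fun a _ => ?_).symm
    rw [encoder_apply, if_neg, zero_mul]
    intro h
    refine hx fun b hb => ?_
    rw [← sub_add_cancel x (∑ i, a i • L i), dotProduct_add, hXZ _ h b hb,
      hL.dotProduct_sum_smul hb, add_zero]

theorem mul_encoder_eq (hXZ : ∀ s ∈ SX, ∀ b ∈ SZ, b ⬝ᵥ s = 0)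
    (hL : IsLogicalBasis SX SZ L) {V : Op Q}
    (hV : ∀ ψ ∈ codeSpace SX SZ, V *ᵥ ψ ∈ codeSpace SX SZ) :
    V * encoder SX L = encoder SX L * encodedGate SX L V := by
  have key : ∀ φ, V *ᵥ (encoder SX L *ᵥ φ) =
      encoder SX L *ᵥ ((encoder SX L)ᴴ *ᵥ (V *ᵥ (encoder SX L *ᵥ φ))) := by
    intro φ
    obtain ⟨χ, hχ⟩ := exists_eq_encoder_mulVec hXZ hL
      (hV _ (encoder_mul_mem_codeSpace hXZ hL φ))
    rw [hχ, Matrix.mulVec_mulVec (M := (encoder SX L)ᴴ), encoder_isometry hL, Matrix.one_mulVec]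
  refine Matrix.ext_of_mulVec_single fun a => ?_
  have := key (Pi.single a 1)
  simpa only [encodedGate, Matrix.mulVec_mulVec, Matrix.mul_assoc] using this

/-- Since `V` maps the code space onto itself, `V†` preserves it as well. -/
theorem IsLogicalGate.implements (hXZ : ∀ s ∈ SX, ∀ b ∈ SZ, b ⬝ᵥ s = 0)
    (hL : IsLogicalBasis SX SZ L) {V : Op Q} (hV : IsLogicalGate SX SZ V) :
    Implements (encoder SX L) V (encodedGate SX L V) := by
  obtain ⟨hU, hmap⟩ := hV
  refine ⟨hU, mul_encoder_eq hXZ hL fun ψ hψ => ?_, ?_⟩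
  · rw [← hmap]
    exact Submodule.mem_map_of_mem (f := V.mulVecLin) hψ
  · have : (encodedGate SX L V)ᴴ = encodedGate SX L Vᴴ := by
      simp [encodedGate, Matrix.conjTranspose_mul, Matrix.mul_assoc]
    rw [this]
    refine mul_encoder_eq hXZ hL fun ψ hψ => ?_
    rw [← hmap] at hψ
    obtain ⟨φ, hφ, rfl⟩ := hψ
    rw [Matrix.mulVecLin_apply, Matrix.mulVec_mulVec, conjTranspose_mul_self_of_mem hU,
      Matrix.one_mulVec]
    exact hφ

/-! ## Logical Pauli operators -/

theorem implements_pauliX {v : Q → ZMod 2} {a : Fin k → ZMod 2}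
    (hv : v - ∑ i, a i • L i ∈ SX) : Implements (encoder SX L) (pauliX v) (pauliX a) := by
  classical
  have h : pauliX v * encoder SX L = encoder SX L * pauliX a := by
    ext x b
    rw [pauliX_mul_apply, mul_pauliX_apply, encoder_apply, encoder_apply]
    have e : x + v - ∑ i, b i • L i =
        (x - ∑ i, (b + a) i • L i) + (v - ∑ i, a i • L i) := by
      rw [sum_smul_add]
      simp only [ZModModule.sub_eq_add]
      have := ZModModule.add_self (∑ i, a i • L i)
      linear_combination (exp := 1) -this
    simp only [e, SX.add_mem_iff_left hv]
  exact ⟨pauliX_mem_unitaryGroup v, h, by rwa [pauliX_conjTranspose, pauliX_conjTranspose]⟩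

theorem implements_pauliZ {w : Q → ZMod 2} {b : Fin k → ZMod 2}
    (hw : ∀ s ∈ SX, w ⬝ᵥ s = 0) (hwL : ∀ i, w ⬝ᵥ L i = b i) :
    Implements (encoder SX L) (pauliZ w) (pauliZ b) := by
  classical
  have h : pauliZ w * encoder SX L = encoder SX L * pauliZ b := by
    ext x a
    rw [pauliZ_mul_apply, mul_pauliZ_apply, encoder_apply]
    split_ifs with h
    · have e : w ⬝ᵥ x = b ⬝ᵥ a := by
        rw [← sub_add_cancel x (∑ i, a i • L i), dotProduct_add, hw _ h, zero_add,
          dotProduct_sum]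
        simp only [dotProduct_smul, hwL, smul_eq_mul]
        simp only [dotProduct, mul_comm]
      rw [e, mul_comm]
    · simp
  exact ⟨pauliZ_mem_unitaryGroup w, h, by rwa [pauliZ_conjTranspose, pauliZ_conjTranspose]⟩

/-- Dual logical `Z` operators exist. -/
theorem IsLogicalBasis.exists_dual (hL : IsLogicalBasis SX SZ L)
    (b : Fin k → ZMod 2) :
    ∃ w : Q → ZMod 2, (∀ s ∈ SX, w ⬝ᵥ s = 0) ∧ ∀ i, w ⬝ᵥ L i = b i := by
  -- The images of `L` are independent modulo `SX`, so prescribed values extend to a functional on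
  -- the quotient, which vanishes on `SX` automatically.
  have hli : LinearIndependent (ZMod 2) (SX.mkQ ∘ L) := by
    rw [Fintype.linearIndependent_iff]
    intro g hg
    have h1 : (0 : Q → ZMod 2) - ∑ i, g i • L i ∈ SX := by
      rw [zero_sub, SX.neg_mem_iff, ← SX.ker_mkQ, LinearMap.mem_ker, map_sum]
      simpa using hg
    have h2 := hL.eq_of_sub_mem h1 (b := 0) (by simp)
    exact fun i => congr_fun h2 i
  obtain ⟨f, hf⟩ := LinearMap.exists_extend
    ((Module.Basis.span hli).constr (ZMod 2) b)
  have hfL : ∀ i, f (SX.mkQ (L i)) = b i := by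
    intro i
    have := LinearMap.congr_fun hf (Module.Basis.span hli i)
    rw [Module.Basis.constr_basis] at this
    simpa [Module.Basis.span_apply] using this
  refine ⟨fun q => f (SX.mkQ (Pi.single q 1)), ?_⟩
  have hdot : ∀ x : Q → ZMod 2, (fun q => f (SX.mkQ (Pi.single q 1))) ⬝ᵥ x = f (SX.mkQ x) := by
    intro x
    conv_rhs => rw [pi_eq_sum_univ' x]
    simp [dotProduct, mul_comm]
  refine ⟨fun s hs => ?_, fun i => ?_⟩
  · rw [hdot, (Submodule.Quotient.mk_eq_zero SX).2 hs |> fun h => (h : SX.mkQ s = 0), map_zero]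
  · rw [hdot, hfL]

end Encoding

/-! ## Operators acting along one axis -/

section Axis

variable {ι : Type*} [Fintype ι] [DecidableEq ι] {X : ι → Type*} [∀ i, Fintype (X i)]
  [∀ i, DecidableEq (X i)]

/-- The operator acting by the matrix `B` on the `j`-th tensor factor. -/
def axisOp (j : ι) (B : Matrix (X j) (X j) (ZMod 2)) :
    Module.End (ZMod 2) ((∀ i, X i) → ZMod 2) where
  toFun v y := ∑ a, B (y j) a * v (Function.update y j a)
  map_add' v w := by ext y; simp [mul_add, Finset.sum_add_distrib]
  map_smul' c v := by ext y; simp [Finset.mul_sum, mul_left_comm]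

theorem axisOp_apply (j : ι) (B : Matrix (X j) (X j) (ZMod 2)) (v : (∀ i, X i) → ZMod 2)
    (y : ∀ i, X i) : axisOp j B v y = ∑ a, B (y j) a * v (Function.update y j a) := rfl

theorem axisOp_mul (j : ι) (B C : Matrix (X j) (X j) (ZMod 2)) :
    axisOp j (B * C) = axisOp j B * axisOp j C := by
  refine LinearMap.ext fun v => funext fun y => ?_
  simp only [Module.End.mul_apply, axisOp_apply, Matrix.mul_apply, Finset.sum_mul,
    Finset.mul_sum, Function.update_self, Function.update_idem]
  rw [Finset.sum_comm]
  simp only [mul_assoc]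

theorem axisOp_add (j : ι) (B C : Matrix (X j) (X j) (ZMod 2)) :
    axisOp j (B + C) = axisOp j B + axisOp j C := by
  refine LinearMap.ext fun v => funext fun y => ?_
  simp [axisOp_apply, add_mul, Finset.sum_add_distrib]

theorem axisOp_one (j : ι) : axisOp j (1 : Matrix (X j) (X j) (ZMod 2)) = 1 := by
  refine LinearMap.ext fun v => funext fun y => ?_
  simp [axisOp_apply, Matrix.one_apply]

theorem axisOp_zero (j : ι) : axisOp j (0 : Matrix (X j) (X j) (ZMod 2)) = 0 := by
  refine LinearMap.ext fun v => funext fun y => ?_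
  simp [axisOp_apply]

theorem axisOp_commute {i j : ι} (hij : i ≠ j) (B : Matrix (X i) (X i) (ZMod 2))
    (C : Matrix (X j) (X j) (ZMod 2)) : Commute (axisOp i B) (axisOp j C) := by
  rw [Commute, SemiconjBy]
  refine LinearMap.ext fun v => funext fun y => ?_
  simp only [Module.End.mul_apply, axisOp_apply, Finset.mul_sum]
  rw [Finset.sum_comm]
  refine Finset.sum_congr rfl fun a _ => Finset.sum_congr rfl fun b _ => ?_
  rw [Function.update_of_ne hij.symm, Function.update_of_ne hij, Function.update_comm hij]
  ring

theorem exists_ne_zero_of_axisOp_apply_ne_zero {j : ι} {B : Matrix (X j) (X j) (ZMod 2)}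
    {v : (∀ i, X i) → ZMod 2} {y : ∀ i, X i} (h : axisOp j B v y ≠ 0) :
    ∃ a, B (y j) a ≠ 0 ∧ v (Function.update y j a) ≠ 0 := by
  obtain ⟨a, -, ha⟩ := Finset.exists_ne_zero_of_sum_ne_zero h
  exact ⟨a, left_ne_zero_of_mul ha, right_ne_zero_of_mul ha⟩

/-- The differential of the tensor product of the complexes with differentials `δ j`. -/
def totalOp (δ : ∀ j, Matrix (X j) (X j) (ZMod 2)) :
    Module.End (ZMod 2) ((∀ i, X i) → ZMod 2) :=
  ∑ j, axisOp j (δ j)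

/-- The mixed terms occur twice and cancel over `𝔽₂`. -/
theorem totalOp_mul_self {δ : ∀ j, Matrix (X j) (X j) (ZMod 2)} (hδ : ∀ j, δ j * δ j = 0) :
    totalOp δ * totalOp δ = 0 := by
  have key : ∀ s : Finset ι, (∑ j ∈ s, axisOp j (δ j)) * (∑ j ∈ s, axisOp j (δ j)) = 0 := by
    intro s
    induction s using Finset.induction_on with
    | empty => simp
    | insert i s hi ih =>
      have hc : Commute (axisOp i (δ i)) (∑ j ∈ s, axisOp j (δ j)) :=
        Commute.sum_right _ _ _ fun j hj => axisOp_commute (ne_of_mem_of_not_mem hj hi).symm _ _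
      rw [Finset.sum_insert hi, add_mul, mul_add, mul_add, ih, ← axisOp_mul, hδ, axisOp_zero,
        ← hc.eq, zero_add, add_zero, ZModModule.add_self]
  exact key _

/-- The other axes commute with `H` and cancel in characteristic two, so a homotopy of one factor
acts as a homotopy of the product. -/
theorem totalOp_mul_axisOp_add (δ : ∀ j, Matrix (X j) (X j) (ZMod 2)) (j : ι)
    (H : Matrix (X j) (X j) (ZMod 2)) :
    totalOp δ * axisOp j H + axisOp j H * totalOp δ = axisOp j (δ j * H + H * δ j) := by
  rw [totalOp, ← Finset.add_sum_erase _ _ (Finset.mem_univ j), add_mul, mul_add, axisOp_add,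
    axisOp_mul, axisOp_mul]
  have hc : Commute (axisOp j H) (∑ i ∈ Finset.univ.erase j, axisOp i (δ i)) :=
    Commute.sum_right _ _ _ fun i hi => axisOp_commute (Finset.ne_of_mem_erase hi).symm _ _
  rw [hc.eq, add_add_add_comm, ZModModule.add_self, add_zero]

/-- If every factor retracts up to homotopy onto the span of the basis elements in `G j`, then
every cycle is homologous to one supported on the product of the sets `G j`. -/
theorem exists_totalOp_add_support {δ H : ∀ j, Matrix (X j) (X j) (ZMod 2)}
    (hδ : ∀ j, δ j * δ j = 0) {G : ∀ j, Set (X j)}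
    (hG : ∀ j, ∀ x ∉ G j, ∀ y, (1 + δ j * H j + H j * δ j) x y = 0)
    {v : (∀ i, X i) → ZMod 2} (hv : totalOp δ v = 0) :
    ∃ w, ∀ x, (v + totalOp δ w) x ≠ 0 → ∀ j, x j ∈ G j := by
  suffices h : ∀ s : Finset ι, ∃ w, ∀ x, (v + totalOp δ w) x ≠ 0 → ∀ j ∈ s, x j ∈ G j by
    obtain ⟨w, hw⟩ := h Finset.univ
    exact ⟨w, fun x hx j => hw x hx j (Finset.mem_univ j)⟩
  intro s
  induction s using Finset.induction_on with
  | empty => exact ⟨0, by simp⟩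
  | insert i s hi ih =>
    obtain ⟨w, hw⟩ := ih
    set u := v + totalOp δ w with hu
    have hu0 : totalOp δ u = 0 := by
      rw [hu, map_add, hv, zero_add, ← Module.End.mul_apply, totalOp_mul_self hδ,
        LinearMap.zero_apply]
    refine ⟨w + axisOp i (H i) u, fun x hx j hj => ?_⟩
    -- As `u` is a cycle, adding the boundary of `H u` applies the retraction of the `i`-th factor.
    -- It alters only the `i`-th coordinate, so the constraints on the axes already treated survive.
    have e : v + totalOp δ (w + axisOp i (H i) u) =
        axisOp i (1 + δ i * H i + H i * δ i) u := by
      rw [add_assoc (1 : Matrix (X i) (X i) (ZMod 2)), axisOp_add, axisOp_one,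
        ← totalOp_mul_axisOp_add, map_add, ← add_assoc, ← hu]
      simp [hu0]
    rw [e] at hx
    obtain ⟨a, ha, hua⟩ := exists_ne_zero_of_axisOp_apply_ne_zero hx
    by_cases hji : j = i
    · subst hji
      by_contra hne
      exact ha (hG j _ hne a)
    · have := hw _ hua j ((Finset.mem_insert.1 hj).resolve_left hji)
      rwa [Function.update_of_ne hji] at this

end Axis

/-! ## Information sets of the seed codes -/

theorem eq_zero_of_support_subset_of_card_lt {a b : ℕ} {H : Matrix (Fin a) (Fin b) (ZMod 2)} {F : Finset (Fin b)}
    (hF : (F.card : ℕ∞) < codeDist H) {x : Fin b → ZMod 2} (hx : H *ᵥ x = 0)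
    (hxF : ∀ i, x i ≠ 0 → i ∈ F) : x = 0 := by
  by_contra hne
  have h1 : codeDist H ≤ (hammingNorm x : ℕ∞) :=
    iInf_le (fun x : {x : Fin b → ZMod 2 // H *ᵥ x = 0 ∧ x ≠ 0} => (hammingNorm x.1 : ℕ∞))
      ⟨x, hx, hne⟩
  have h2 : hammingNorm x ≤ F.card := Finset.card_le_card fun i hi =>
    hxF i (Finset.mem_filter.1 hi).2
  exact absurd (hF.trans_le h1) (not_lt.2 (Nat.cast_le.2 h2))

/-- A set of fewer positions than the distance is avoided by an information set. -/
theorem exists_information_set {a b : ℕ} (H : Matrix (Fin a) (Fin b) (ZMod 2))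
    (F : Finset (Fin b)) (hF : (F.card : ℕ∞) < codeDist H) :
    ∃ G : Finset (Fin b), Disjoint G F ∧ G.card ≤ codeDim H ∧
      ∃ h : Matrix (Fin a) (Fin b) (ZMod 2), ∀ i ∉ G, ∀ j, (1 + Hᵀ * h : Matrix (Fin b) (Fin b) (ZMod 2)) i j = 0 := by
  classical
  set I := LinearMap.range (Hᵀ).mulVecLin with hI
  set e : Fin b → (Fin b → ZMod 2) ⧸ I := fun i => I.mkQ (Pi.single i 1) with he
  have hdot : ∀ (f : ((Fin b → ZMod 2) ⧸ I) →ₗ[ZMod 2] ZMod 2) (x : Fin b → ZMod 2),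
      (fun i => f (e i)) ⬝ᵥ x = f (I.mkQ x) := by
    intro f x
    conv_rhs => rw [pi_eq_sum_univ' x]
    simp [dotProduct, mul_comm, he]
  -- A functional on the quotient by the row space is a codeword of `H`. One that kills the unit
  -- vectors off `F` is supported in `F`, hence zero by the distance.
  have hspan : Submodule.span (ZMod 2) (e '' {i | i ∉ F}) = ⊤ := by
    by_contra hne
    obtain ⟨f, hf0, hf⟩ := Submodule.exists_le_ker_of_lt_top _ (lt_top_iff_ne_top.2 hne)
    apply hf0
    have hx : (fun i => f (e i)) = 0 := by
      refine eq_zero_of_support_subset_of_card_lt hF ?_ fun i hi => ?_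
      · ext r
        rw [Matrix.mulVec, dotProduct_comm, hdot]
        have : I.mkQ (H.row r) = 0 := by
          rw [← LinearMap.mem_ker, Submodule.ker_mkQ]
          exact ⟨Pi.single r 1, by ext; simp⟩
        rw [show (fun j => H r j) = H.row r from rfl, this, map_zero]; rfl
      · by_contra hiF
        exact hi (hf (Submodule.subset_span ⟨i, hiF, rfl⟩))
    refine Submodule.linearMap_qext _ (LinearMap.ext fun x => ?_)
    rw [LinearMap.comp_apply, ← hdot, hx, zero_dotProduct]
    rfl
  have hdim : Module.finrank (ZMod 2) ((Fin b → ZMod 2) ⧸ I) = codeDim H := by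
    have h1 := Submodule.finrank_quotient_add_finrank I
    have h2 := LinearMap.finrank_range_add_finrank_ker H.mulVecLin
    have h3 : Module.finrank (ZMod 2) I = H.rank := Matrix.rank_transpose H
    have h4 : H.rank = Module.finrank (ZMod 2) (LinearMap.range H.mulVecLin) := rfl
    rw [codeDim]
    omega
  obtain ⟨g, hg, hgs, -⟩ := Submodule.exists_fun_fin_finrank_span_eq (ZMod 2) (e '' {i | i ∉ F})
  choose c hcF hc using hg
  refine ⟨Finset.univ.image c, ?_, ?_, ?_⟩
  · rw [Finset.disjoint_left]
    intro i hi
    obtain ⟨p, -, rfl⟩ := Finset.mem_image.1 hi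
    exact hcF p
  · refine Finset.card_image_le.trans ?_
    rw [Finset.card_univ, Fintype.card_fin, hspan, finrank_top, hdim]
  -- Modulo the row space each unit vector is a combination of unit vectors in the information set;
  -- the row-space correction gives the `j`-th column of `h`.
  · have hu : ∀ j, ∃ u : Fin a → ZMod 2, ∀ i ∉ Finset.univ.image c,
        (Pi.single j 1 : Fin b → ZMod 2) i + (Hᵀ *ᵥ u) i = 0 := by
      intro j
      have hj : e j ∈ Submodule.span (ZMod 2) (Set.range g) := by
        rw [hgs, hspan]; trivial
      obtain ⟨d, hd⟩ := (Submodule.mem_span_range_iff_exists_fun _).1 hj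
      have h0 : Pi.single j 1 - ∑ p, d p • Pi.single (c p) (1 : ZMod 2) ∈ I := by
        refine (Submodule.Quotient.mk_eq_zero I).1 ?_
        change I.mkQ _ = 0
        rw [map_sub, map_sum, sub_eq_zero]
        simp only [map_smul]
        rw [show I.mkQ (Pi.single j 1) = e j from rfl, ← hd]
        exact Finset.sum_congr rfl fun p _ => by rw [← hc p]
      obtain ⟨u, hu⟩ := h0
      refine ⟨u, fun i hi => ?_⟩
      rw [Matrix.mulVecLin_apply] at hu
      rw [hu, Pi.sub_apply, Finset.sum_apply, Finset.sum_eq_zero fun p _ => ?_, sub_zero,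
        ZModModule.add_self]
      rw [Pi.smul_apply, Pi.single_eq_of_ne, smul_zero]
      rintro rfl
      exact hi (Finset.mem_image_of_mem _ (Finset.mem_univ p))
    choose u hu using hu
    refine ⟨fun r j => u j r, fun i hi j => ?_⟩
    rw [← hu j i hi, Matrix.add_apply, Matrix.one_apply, Pi.single_apply]
    rfl

section Product

variable {t : ℕ} (S : SeedCodes t)

/-! ## The boundary map of the product complex -/

/-- The differential of a seed complex, in the basis of both of its degrees. -/
def seedOp (j : Fin t) : Matrix (Fin (S.n j) ⊕ Fin (S.m j)) (Fin (S.n j) ⊕ Fin (S.m j)) (ZMod 2) :=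
  Matrix.fromBlocks 0 0 (S.A j) 0

theorem seedOp_mul_self (j : Fin t) : seedOp S j * seedOp S j = 0 := by
  simp [seedOp, Matrix.fromBlocks_multiply]

theorem boundaryEntry_eq (y x : Cell S) : boundaryEntry S y x =
    ∑ j, if ∀ i, i ≠ j → x i = y i then seedOp S j (y j) (x j) else 0 := by
  refine Finset.sum_congr rfl fun j _ => ?_
  rcases hx : x j with a | a <;> rcases hy : y j with b | b <;> simp [seedOp]

theorem sum_agree_off {M : Type*} [AddCommMonoid M] (y : Cell S) (j : Fin t) (f : Cell S → M) :
    ∑ x, (if ∀ i, i ≠ j → x i = y i then f x else 0) = ∑ a, f (Function.update y j a) := by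
  rw [← Finset.sum_filter]
  symm
  refine Finset.sum_bij (fun a _ => Function.update y j a) (fun a _ => ?_) (fun a _ b _ h => ?_)
    (fun x hx => ?_) (fun _ _ => rfl)
  · rw [Finset.mem_filter]
    exact ⟨Finset.mem_univ _, fun i hi => Function.update_of_ne hi _ _⟩
  · exact Function.update_injective y j h
  · refine ⟨x j, Finset.mem_univ _, ?_⟩
    ext1 i
    by_cases hi : i = j
    · subst hi; simp
    · rw [Function.update_of_ne hi, (Finset.mem_filter.1 hx).2 i hi]

theorem totalOp_seedOp_apply (w : Cell S → ZMod 2) (y : Cell S) :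
    totalOp (seedOp S) w y = ∑ x, boundaryEntry S y x * w x := by
  simp only [boundaryEntry_eq, Finset.sum_mul, ite_mul, zero_mul]
  rw [Finset.sum_comm, totalOp, LinearMap.sum_apply, Finset.sum_apply]
  refine Finset.sum_congr rfl fun j _ => ?_
  rw [sum_agree_off S y j fun x => seedOp S j (y j) (x j) * w x, axisOp_apply]
  simp

theorem totalOp_seedOp_transpose_apply (w : Cell S → ZMod 2) (x : Cell S) :
    totalOp (fun j => (seedOp S j)ᵀ) w x = ∑ y, boundaryEntry S y x * w y := by
  simp only [boundaryEntry_eq, Finset.sum_mul, ite_mul, zero_mul]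
  rw [Finset.sum_comm, totalOp, LinearMap.sum_apply, Finset.sum_apply]
  refine Finset.sum_congr rfl fun j _ => ?_
  have := sum_agree_off S x j fun y => seedOp S j (y j) (x j) * w y
  simp only [eq_comm (b := x _)] at this
  rw [this, axisOp_apply]
  simp

/-- This lets the graded boundary maps be studied through the single differential `totalOp` on all
cells. -/
theorem card_cellSector_of_boundaryEntry_ne_zero {y x : Cell S} (h : boundaryEntry S y x ≠ 0) :
    (cellSector x).card = (cellSector y).card + 1 := by
  rw [boundaryEntry_eq] at h
  obtain ⟨j, -, hj⟩ := Finset.exists_ne_zero_of_sum_ne_zero h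
  rw [ite_ne_right_iff] at hj
  obtain ⟨hoff, hj⟩ := hj
  have hxj : (x j).isLeft = true ∧ (y j).isLeft = false := by
    rcases hx : x j with a | a <;> rcases hy : y j with b | b <;> rw [hx, hy] at hj <;>
      simp [seedOp] at hj ⊢
  have : cellSector x = insert j (cellSector y) := by
    ext i
    by_cases hi : i = j
    · subst hi; simp [cellSector, hxj.1]
    · simp [cellSector, hi, hoff i hi]
  rw [this, Finset.card_insert_of_notMem]
  simp [cellSector, hxj.2]

/-- Extension by zero of a `p`-chain to all cells. -/
def extendCell (p : ℕ) (v : CellAt S p → ZMod 2) : Cell S → ZMod 2 :=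
  fun x => if h : (cellSector x).card = p then v ⟨x, h⟩ else 0

theorem extendCell_apply {p : ℕ} (v : CellAt S p → ZMod 2) (x : CellAt S p) :
    extendCell S p v x.1 = v x := by
  simp [extendCell, x.2]

theorem sum_cellAt_eq_sum {p : ℕ} (f : Cell S → ZMod 2)
    (hf : ∀ x, f x ≠ 0 → (cellSector x).card = p) : ∑ x : CellAt S p, f x.1 = ∑ x, f x := by
  rw [← Finset.sum_filter_of_ne (p := fun x => (cellSector x).card = p) fun x _ => hf x]
  exact (Finset.sum_subtype _ (by simp) f).symm

theorem boundary_mulVec_restrict {p q : ℕ} (hpq : q = p + 1) (w : Cell S → ZMod 2)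
    (y : CellAt S p) :
    (boundary S p q *ᵥ fun x => w x.1) y = totalOp (seedOp S) w y.1 := by
  rw [totalOp_seedOp_apply]
  refine sum_cellAt_eq_sum S (fun x => boundaryEntry S y.1 x * w x) fun x hx => ?_
  rw [card_cellSector_of_boundaryEntry_ne_zero S (left_ne_zero_of_mul hx), y.2, hpq]

theorem boundary_transpose_mulVec_restrict {p q : ℕ} (hpq : q = p + 1) (w : Cell S → ZMod 2)
    (x : CellAt S q) :
    ((boundary S p q)ᵀ *ᵥ fun y => w y.1) x = totalOp (fun j => (seedOp S j)ᵀ) w x.1 := by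
  rw [totalOp_seedOp_transpose_apply]
  refine sum_cellAt_eq_sum S (fun y => boundaryEntry S y x.1 * w y) fun y hy => ?_
  have := card_cellSector_of_boundaryEntry_ne_zero S (left_ne_zero_of_mul hy)
  rw [x.2, hpq] at this
  exact (Nat.succ.inj this).symm

theorem totalOp_extendCell_eq_zero {p q : ℕ} (hpq : q = p + 1) {v : CellAt S q → ZMod 2}
    (hv : boundary S p q *ᵥ v = 0) : totalOp (seedOp S) (extendCell S q v) = 0 := by
  ext y
  by_cases hy : (cellSector y).card = p
  · rw [← boundary_mulVec_restrict S hpq _ ⟨y, hy⟩]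
    simp only [extendCell_apply, hv]
    rfl
  · rw [totalOp_seedOp_apply]
    refine Finset.sum_eq_zero fun x _ => ?_
    by_contra hne
    have h1 := card_cellSector_of_boundaryEntry_ne_zero S (left_ne_zero_of_mul hne)
    have h2 : (cellSector x).card = q := by
      by_contra h; exact right_ne_zero_of_mul hne (dif_neg h)
    omega

theorem totalOp_transpose_extendCell_eq_zero {p q : ℕ} (hpq : q = p + 1)
    {v : CellAt S p → ZMod 2} (hv : (boundary S p q)ᵀ *ᵥ v = 0) :
    totalOp (fun j => (seedOp S j)ᵀ) (extendCell S p v) = 0 := by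
  ext y
  by_cases hy : (cellSector y).card = q
  · rw [← boundary_transpose_mulVec_restrict S hpq _ ⟨y, hy⟩]
    simp only [extendCell_apply, hv]
    rfl
  · rw [totalOp_seedOp_transpose_apply]
    refine Finset.sum_eq_zero fun x _ => ?_
    by_contra hne
    have h1 := card_cellSector_of_boundaryEntry_ne_zero S (left_ne_zero_of_mul hne)
    have h2 : (cellSector x).card = p := by
      by_contra h; exact right_ne_zero_of_mul hne (dif_neg h)
    omega

theorem boundary_mul_boundary {p q r : ℕ} (hpq : q = p + 1) (hqr : r = q + 1) :
    boundary S p q * boundary S q r = 0 := by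
  refine Matrix.ext_of_mulVec_single fun a => ?_
  set u : CellAt S r → ZMod 2 := Pi.single a 1
  have h1 : boundary S q r *ᵥ u =
      fun x => totalOp (seedOp S) (extendCell S r u) x.1 := by
    ext x
    rw [← boundary_mulVec_restrict S hqr]
    simp only [extendCell_apply]
  ext y
  rw [← Matrix.mulVec_mulVec, h1, boundary_mulVec_restrict S hpq, ← Module.End.mul_apply,
    totalOp_mul_self (seedOp_mul_self S), Matrix.zero_mulVec]
  rfl

theorem xStab_orthogonal_zStab {l : ℕ} (hl : 1 ≤ l) :
    ∀ s ∈ xStab S l, ∀ b ∈ zStab S l, b ⬝ᵥ s = 0 := by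
  rintro _ ⟨u, rfl⟩ _ ⟨w, rfl⟩
  rw [Matrix.mulVecLin_apply, Matrix.mulVecLin_apply, Matrix.mulVec_transpose, dotProduct_comm,
    ← Matrix.dotProduct_mulVec, Matrix.mulVec_mulVec,
    boundary_mul_boundary S (Nat.sub_add_cancel hl).symm rfl, Matrix.zero_mulVec,
    dotProduct_zero]

theorem transpose_mulVec_eq_zero {m n : Type*} [Fintype m] [Fintype n] [DecidableEq n]
    {B : Matrix m n (ZMod 2)} {v : m → ZMod 2}
    (h : ∀ b ∈ LinearMap.range B.mulVecLin, b ⬝ᵥ v = 0) : Bᵀ *ᵥ v = 0 := by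
  ext i
  have := h _ ⟨Pi.single i 1, rfl⟩
  rw [Matrix.mulVecLin_apply, dotProduct_comm, Matrix.dotProduct_mulVec, dotProduct_single,
    mul_one] at this
  rwa [Matrix.mulVec_transpose]

/-! ## Canonical representatives avoiding given positions -/

theorem one_le_dMin {a b : ℕ} (H : Matrix (Fin a) (Fin b) (ZMod 2)) : 1 ≤ dMin H := by
  have key : ∀ {a b : ℕ} (H : Matrix (Fin a) (Fin b) (ZMod 2)), 1 ≤ codeDist H := by
    intro a b H
    refine le_iInf fun x => ?_
    have : 0 < hammingNorm x.1 := hammingNorm_pos_iff.2 x.2.2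
    exact_mod_cast this
  exact le_min (key _) (key _)

/-- Cocycles have representatives that, along the axes in degree one, only occupy an information
set off the given positions. -/
theorem exists_cocycle_representative {l : ℕ} (hl : 1 ≤ l)
    (F : ∀ j, Finset (Fin (S.n j) ⊕ Fin (S.m j)))
    (hF : ∀ j, ((F j).card : ℕ∞) < dMin (S.A j)) :
    ∃ G : ∀ j, Finset (Fin (S.n j) ⊕ Fin (S.m j)),
      (∀ j, Disjoint (G j) (F j) ∧ (G j).card ≤ kMax (S.A j)) ∧
      ∀ v : CellAt S l → ZMod 2, (∀ b ∈ zStab S l, b ⬝ᵥ v = 0) →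
        ∃ v', v' - v ∈ xStab S l ∧ ∀ q, v' q ≠ 0 → ∀ i ∈ cellSector q.1, q.1 i ∈ G i := by
  have hinfo : ∀ j, ∃ G : Finset (Fin (S.n j)), Disjoint G (F j).toLeft ∧
      G.card ≤ codeDim (S.A j) ∧
      ∃ h : Matrix (Fin (S.m j)) (Fin (S.n j)) (ZMod 2), ∀ i ∉ G, ∀ i',
        (1 + (S.A j)ᵀ * h : Matrix (Fin (S.n j)) (Fin (S.n j)) (ZMod 2)) i i' = 0 := fun j =>
    exists_information_set (S.A j) (F j).toLeft
      (lt_of_le_of_lt (Nat.cast_le.2 Finset.card_toLeft_le) ((hF j).trans_le (min_le_left _ _)))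
  choose G hGF hGk h hh using hinfo
  refine ⟨fun j => (G j).map Function.Embedding.inl, fun j => ⟨?_, ?_⟩, fun v hv => ?_⟩
  · rw [Finset.disjoint_left]
    intro x hx hxF
    obtain ⟨i, hi, rfl⟩ := Finset.mem_map.1 hx
    exact Finset.disjoint_left.1 (hGF j) hi (Finset.mem_toLeft.2 hxF)
  · rw [Finset.card_map]
    exact (hGk j).trans (le_max_left _ _)
  -- In degree one the retraction is `1 + Aᵀ h`, which lands on the information set; positions in
  -- degree zero are left unconstrained.
  · obtain ⟨w, hw⟩ := exists_totalOp_add_support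
      (δ := fun j => (seedOp S j)ᵀ) (H := fun j => Matrix.fromBlocks 0 0 (h j) 0)
      (G := fun j => {x | x.isLeft = true → x ∈ (G j).map Function.Embedding.inl})
      (fun j => by rw [← Matrix.transpose_mul, seedOp_mul_self, Matrix.transpose_zero])
      (fun j x hx y => by
        rcases x with i | i
        · have hi : i ∉ G j := fun hi => hx fun _ => Finset.mem_map_of_mem _ hi
          rcases y with i' | i'
          · have := hh j i hi i'
            simpa [seedOp, Matrix.fromBlocks_transpose, Matrix.fromBlocks_multiply,
              Matrix.one_apply] using this
          · simp [seedOp, Matrix.fromBlocks_transpose, Matrix.fromBlocks_multiply]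
        · exact absurd (fun h => by simp at h) hx)
      (totalOp_transpose_extendCell_eq_zero S (p := l) rfl (transpose_mulVec_eq_zero hv))
    refine ⟨fun q => (extendCell S l v + totalOp (fun j => (seedOp S j)ᵀ) w) q.1, ?_,
      fun q hq i hi => hw q.1 hq i (Finset.mem_filter.1 hi).2⟩
    refine ⟨fun y => w y.1, ?_⟩
    ext q
    rw [Matrix.mulVecLin_apply,
      boundary_transpose_mulVec_restrict S (Nat.sub_add_cancel hl).symm]
    simp [extendCell_apply]

/-- Cycles have representatives that, along the axes in degree zero, only occupy an information
set off the given positions. -/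
theorem exists_cycle_representative {l : ℕ} (hl : 1 ≤ l)
    (F : ∀ j, Finset (Fin (S.n j) ⊕ Fin (S.m j)))
    (hF : ∀ j, ((F j).card : ℕ∞) < dMin (S.A j)) :
    ∃ G : ∀ j, Finset (Fin (S.n j) ⊕ Fin (S.m j)),
      (∀ j, Disjoint (G j) (F j) ∧ (G j).card ≤ kMax (S.A j)) ∧
      ∀ v : CellAt S l → ZMod 2, (∀ s ∈ xStab S l, s ⬝ᵥ v = 0) →
        ∃ v', v' - v ∈ zStab S l ∧ ∀ q, v' q ≠ 0 → ∀ i ∈ (cellSector q.1)ᶜ, q.1 i ∈ G i := by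
  have hinfo : ∀ j, ∃ G : Finset (Fin (S.m j)), Disjoint G (F j).toRight ∧
      G.card ≤ codeDim (S.A j)ᵀ ∧
      ∃ h : Matrix (Fin (S.n j)) (Fin (S.m j)) (ZMod 2), ∀ i ∉ G, ∀ i',
        (1 + (S.A j)ᵀᵀ * h : Matrix (Fin (S.m j)) (Fin (S.m j)) (ZMod 2)) i i' = 0 := fun j =>
    exists_information_set (S.A j)ᵀ (F j).toRight
      (lt_of_le_of_lt (Nat.cast_le.2 Finset.card_toRight_le)
        ((hF j).trans_le (min_le_right _ _)))
  choose G hGF hGk h hh using hinfo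
  refine ⟨fun j => (G j).map Function.Embedding.inr, fun j => ⟨?_, ?_⟩, fun v hv => ?_⟩
  · rw [Finset.disjoint_left]
    intro x hx hxF
    obtain ⟨i, hi, rfl⟩ := Finset.mem_map.1 hx
    exact Finset.disjoint_left.1 (hGF j) hi (Finset.mem_toRight.2 hxF)
  · rw [Finset.card_map]
    exact (hGk j).trans (le_max_right _ _)
  -- Here the degrees trade places: the retraction `1 + A h` confines degree zero, and degree one is
  -- free.
  · obtain ⟨w, hw⟩ := exists_totalOp_add_support
      (δ := fun j => seedOp S j) (H := fun j => Matrix.fromBlocks 0 (h j) 0 0)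
      (G := fun j => {x | x.isLeft = false → x ∈ (G j).map Function.Embedding.inr})
      (fun j => seedOp_mul_self S j)
      (fun j x hx y => by
        rcases x with i | i
        · exact absurd (fun h => by simp at h) hx
        · have hi : i ∉ G j := fun hi => hx fun _ => Finset.mem_map_of_mem _ hi
          rcases y with i' | i'
          · simp [seedOp, Matrix.fromBlocks_multiply]
          · have := hh j i hi i'
            simpa [seedOp, Matrix.fromBlocks_multiply, Matrix.one_apply] using this)
      (totalOp_extendCell_eq_zero S (Nat.sub_add_cancel hl).symm
        (by simpa using transpose_mulVec_eq_zero hv))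
    refine ⟨fun q => (extendCell S l v + totalOp (seedOp S) w) q.1, ?_,
      fun q hq i hi => hw q.1 hq i ?_⟩
    · refine ⟨fun y => w y.1, ?_⟩
      ext q
      rw [Matrix.mulVecLin_apply, boundary_mulVec_restrict S rfl]
      simp [extendCell_apply]
    · simpa [cellSector] using hi

end Product

section Geometry

variable {t l : ℕ} {S : SeedCodes t}

/-! ## Coverings by hypertubes -/

theorem Hypertube.dim_mono {μ : Sector t l} (R : Hypertube S μ) {C C' : ℕ} (h : C ≤ C') :
    R.dim C ≤ R.dim C' := by
  classical
  refine Finset.card_le_card (Finset.monotone_filter_right _ fun i _ hi => hi.trans ?_)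
  exact Nat.cast_le.2 (Nat.mul_le_mul_right _ h)

theorem Hypertube.cellSector_eq {μ : Sector t l} (R : Hypertube S μ) {q : CellAt S l}
    (hq : q ∈ R.region) : cellSector q.1 = μ.1 := by
  ext i
  rw [← R.side_sector i _ (hq i)]
  simp [cellSector]

/-- The set `X` is covered by `m` hypertubes of dimension at most `d` at resolution `C`. -/
def Covered (m C d : ℕ) (X : Set (CellAt S l)) : Prop :=
  ∃ Ts : List (Σ μ : Sector t l, Hypertube S μ), Ts.length ≤ m ∧ (∀ T ∈ Ts, T.2.dim C ≤ d) ∧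
    ∀ q ∈ X, ∃ T ∈ Ts, q ∈ T.2.region

theorem Covered.mono {m m' C C' d d' : ℕ} {X X' : Set (CellAt S l)} (h : Covered m C d X)
    (hm : m ≤ m') (hC : C' ≤ C) (hd : d ≤ d') (hX : X' ⊆ X) : Covered m' C' d' X' := by
  obtain ⟨Ts, h1, h2, h3⟩ := h
  exact ⟨Ts, h1.trans hm, fun T hT => (T.2.dim_mono hC).trans ((h2 T hT).trans hd),
    fun q hq => h3 q (hX hq)⟩

theorem Covered.union {m m' C d : ℕ} {X X' : Set (CellAt S l)} (h : Covered m C d X)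
    (h' : Covered m' C d X') : Covered (m + m') C d (X ∪ X') := by
  obtain ⟨Ts, h1, h2, h3⟩ := h
  obtain ⟨Ts', h1', h2', h3'⟩ := h'
  refine ⟨Ts ++ Ts', by rw [List.length_append]; exact add_le_add h1 h1', fun T hT => ?_, ?_⟩
  · exact (List.mem_append.1 hT).elim (h2 T) (h2' T)
  · rintro q (hq | hq)
    · obtain ⟨T, hT, hqT⟩ := h3 q hq
      exact ⟨T, List.mem_append_left _ hT, hqT⟩
    · obtain ⟨T, hT, hqT⟩ := h3' q hq
      exact ⟨T, List.mem_append_right _ hT, hqT⟩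

theorem covered_univ (C : ℕ) :
    Covered (Fintype.card (Sector t l)) C t (Set.univ : Set (CellAt S l)) := by
  classical
  let full : ∀ μ : Sector t l, Hypertube S μ := fun μ =>
    ⟨fun i => Finset.univ.filter fun a => a.isLeft = true ↔ i ∈ μ.1,
      fun i a ha => (Finset.mem_filter.1 ha).2⟩
  refine ⟨(Finset.univ : Finset (Sector t l)).toList.map fun μ => ⟨μ, full μ⟩, ?_, ?_, ?_⟩
  · simp
  · intro T _
    exact (Finset.card_le_univ _).trans (Fintype.card_fin t).le
  · intro q _
    refine ⟨⟨⟨cellSector q.1, q.2⟩, full _⟩, List.mem_map.2 ⟨_, by simp, rfl⟩, fun i => ?_⟩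
    simp [full, cellSector]

/-- The operator `V` spreads hypertubes into at most `M` hypertubes that are not longer, up to the
change `f` of the resolution. -/
def SpreadBound (V : Op (CellAt S l)) (M : ℕ) (f : ℕ → ℕ) : Prop :=
  ∀ (C : ℕ) (μ : Sector t l) (R : Hypertube S μ),
    Covered M C (R.dim (f C)) (supportMap V R.region)

theorem SpreadBound.mono {V : Op (CellAt S l)} {M M' : ℕ} {f f' : ℕ → ℕ}
    (h : SpreadBound V M f) (hM : M ≤ M') (hf : ∀ C, f C ≤ f' C) : SpreadBound V M' f' :=
  fun C μ R => (h C μ R).mono hM le_rfl (R.dim_mono (hf C)) subset_rfl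

/-- The support map is subadditive on unions, so the hypertubes of the covering can be spread one at
a time. -/
theorem SpreadBound.covered_supportMap {V : Op (CellAt S l)} {M : ℕ} {f : ℕ → ℕ}
    (h : SpreadBound V M f) (hV : V ∈ Matrix.unitaryGroup (CellAt S l → ZMod 2) ℂ)
    {m C d : ℕ} {X : Set (CellAt S l)} (hX : Covered m (f C) d X) :
    Covered (m * M) C d (supportMap V X) := by
  obtain ⟨Ts, hm, hd, hTs⟩ := hX
  refine Covered.mono ?_ (Nat.mul_le_mul_right M hm) le_rfl le_rfl (supportMap_mono V hTs)
  clear hm hTs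
  induction Ts with
  | nil =>
    refine ⟨[], by simp, by simp, fun q hq => ?_⟩
    have : {q : CellAt S l | ∃ T ∈ ([] : List (Σ μ : Sector t l, Hypertube S μ)),
        q ∈ T.2.region} = ∅ := by simp
    change q ∈ supportMap V {q : CellAt S l | ∃ T ∈ ([] : List (Σ μ : Sector t l,
      Hypertube S μ)), q ∈ T.2.region} at hq
    rw [this, supportMap_empty hV] at hq
    exact hq.elim
  | cons T Ts ih =>
    have h1 := ih fun T' hT' => hd T' (List.mem_cons_of_mem _ hT')
    have h2 := (h C T.1 T.2).mono le_rfl le_rfl (hd T List.mem_cons_self) subset_rfl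
    refine (h2.union h1).mono (by rw [List.length_cons]; ring_nf; rfl) le_rfl le_rfl
      ((supportMap_mono V fun q hq => ?_).trans (supportMap_union_subset hV _ _))
    obtain ⟨T', hT', hq'⟩ := hq
    rcases List.mem_cons.1 hT' with rfl | hT'
    · exact Or.inl hq'
    · exact Or.inr ⟨T', hT', hq'⟩

theorem SpreadBound.pauliCommutator {V : Op (CellAt S l)} {M : ℕ} {f : ℕ → ℕ}
    (h : SpreadBound V M f) (h' : SpreadBound Vᴴ M f)
    (hV : V ∈ Matrix.unitaryGroup (CellAt S l → ZMod 2) ℂ) (a b : CellAt S l → ZMod 2) :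
    SpreadBound (pauliCommutator V a b) (M * M) (f ∘ f) ∧
      SpreadBound (pauliCommutator V a b)ᴴ (M * M) (f ∘ f) :=
  ⟨fun C μ R => (h.covered_supportMap hV (h' (f C) μ R)).mono le_rfl le_rfl le_rfl
    (supportMap_pauliCommutator_subset V a b _),
  fun C μ R => (h.covered_supportMap hV (h' (f C) μ R)).mono le_rfl le_rfl le_rfl
    (supportMap_pauliCommutator_conjTranspose_subset V a b _)⟩

/-- The short sides of fewer than `C` hypertubes occupy together less than the distance. -/
theorem exists_short_positions {m C : ℕ} (hmC : m < C)
    {Ts : List (Σ μ : Sector t l, Hypertube S μ)} (hTs : Ts.length ≤ m) :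
    ∃ F : ∀ i, Finset (Fin (S.n i) ⊕ Fin (S.m i)),
      (∀ i, ((F i).card : ℕ∞) < dMin (S.A i)) ∧
      ∀ T ∈ Ts, ∀ i, ¬ dMin (S.A i) ≤ ((C * (T.2.side i).card : ℕ) : ℕ∞) →
        T.2.side i ⊆ F i := by
  classical
  refine ⟨fun i => Finset.univ.biUnion fun p : Fin Ts.length =>
    if dMin (S.A i) ≤ ((C * ((Ts.get p).2.side i).card : ℕ) : ℕ∞) then ∅
      else (Ts.get p).2.side i, fun i => ?_, fun T hT i hi => ?_⟩
  · have h1 := one_le_dMin (S.A i)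
    beta_reduce
    generalize dMin (S.A i) = D at h1 ⊢
    cases D with
    | top => exact ENat.natCast_lt_top _
    | coe d =>
      have h1' : 1 ≤ d := by exact_mod_cast h1
      rw [Nat.cast_lt]
      -- A short side has `C * |side| ≤ d - 1`. Fewer than `C` of them occupy at most `d - 1`
      -- positions, which is less than `d` because `d ≥ 1`.
      have hle : ∀ p ∈ (Finset.univ : Finset (Fin Ts.length)),
          (if (d : ℕ∞) ≤ ((C * ((Ts.get p).2.side i).card : ℕ) : ℕ∞) then ∅
            else (Ts.get p).2.side i).card ≤ (d - 1) / C := by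
        intro p _
        split_ifs with hs
        · simp
        · rw [Nat.cast_le, not_le] at hs
          rw [Nat.le_div_iff_mul_le (by omega), mul_comm]
          omega
      have h2 := Finset.card_biUnion_le_card_mul _ _ _ hle
      rw [Finset.card_univ, Fintype.card_fin] at h2
      have h3 : Ts.length * ((d - 1) / C) ≤ C * ((d - 1) / C) :=
        Nat.mul_le_mul_right _ (by omega)
      have h4 := Nat.mul_div_le (d - 1) C
      omega
  · obtain ⟨p, rfl⟩ := List.get_of_mem hT
    refine Finset.subset_biUnion_of_mem (fun p : Fin Ts.length =>
      if dMin (S.A i) ≤ ((C * ((Ts.get p).2.side i).card : ℕ) : ℕ∞) then ∅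
        else (Ts.get p).2.side i) (Finset.mem_univ p) |>.trans' ?_
    simp only [if_neg hi]
    exact subset_rfl

/-- Intersecting hypertubes with a region that is thin along `l` axes, and in these axes avoids the
short sides of the hypertubes, lowers the dimension by `l`. -/
theorem covered_inter_thin {m C d : ℕ} {Ts : List (Σ μ : Sector t l, Hypertube S μ)}
    (hTs : Ts.length ≤ m) (hd : ∀ T ∈ Ts, T.2.dim C ≤ d)
    {F G : ∀ i, Finset (Fin (S.n i) ⊕ Fin (S.m i))}
    (hF : ∀ T ∈ Ts, ∀ i, ¬ dMin (S.A i) ≤ ((C * (T.2.side i).card : ℕ) : ℕ∞) →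
      T.2.side i ⊆ F i)
    (hGF : ∀ i, Disjoint (G i) (F i))
    (hG : ∀ i, ((C * (G i).card : ℕ) : ℕ∞) < dMin (S.A i))
    (κ : Finset (Fin t) → Finset (Fin t)) (hκ : ∀ μ : Sector t l, l ≤ (κ μ.1).card) :
    Covered m C (d - l) {q : CellAt S l | (∃ T ∈ Ts, q ∈ T.2.region) ∧
      ∀ i ∈ κ (cellSector q.1), q.1 i ∈ G i} ∧
    (d < l → {q : CellAt S l | (∃ T ∈ Ts, q ∈ T.2.region) ∧
      ∀ i ∈ κ (cellSector q.1), q.1 i ∈ G i} = ∅) := by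
  classical
  -- A point of the thin region has its `κ`-coordinates in `G`, off all short sides, so its
  -- hypertube is long along every axis of `κ`.
  have hlong : ∀ T ∈ Ts, ∀ q ∈ T.2.region, (∀ i ∈ κ (cellSector q.1), q.1 i ∈ G i) →
      κ T.1.1 ⊆ Finset.univ.filter fun i =>
        dMin (S.A i) ≤ ((C * (T.2.side i).card : ℕ) : ℕ∞) := by
    intro T hT q hqT hqG i hi
    rw [Finset.mem_filter]
    refine ⟨Finset.mem_univ _, ?_⟩
    by_contra hs
    rw [T.2.cellSector_eq hqT] at hqG
    exact Finset.disjoint_left.1 (hGF i) (hqG i hi) (hF T hT i hs (hqT i))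
  constructor
  -- Cutting the `κ`-sides down to `G` makes these axes short, and they were all long before.
  · let cut : (Σ μ : Sector t l, Hypertube S μ) → Σ μ : Sector t l, Hypertube S μ := fun T =>
      ⟨T.1, ⟨fun i => (T.2.side i).filter fun a => i ∈ κ T.1.1 → a ∈ G i,
        fun i a ha => T.2.side_sector i a (Finset.mem_filter.1 ha).1⟩⟩
    refine ⟨(Ts.filter fun T => κ T.1.1 ⊆ Finset.univ.filter fun i =>
        dMin (S.A i) ≤ ((C * (T.2.side i).card : ℕ) : ℕ∞)).map cut, ?_, ?_, ?_⟩
    · rw [List.length_map]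
      exact (List.length_filter_le _ _).trans hTs
    · intro T' hT'
      obtain ⟨T, hT, rfl⟩ := List.mem_map.1 hT'
      obtain ⟨hT, hκT⟩ := List.mem_filter.1 hT
      replace hκT := of_decide_eq_true hκT
      have h1 : (cut T).2.dim C ≤ ((Finset.univ.filter fun i =>
          dMin (S.A i) ≤ ((C * (T.2.side i).card : ℕ) : ℕ∞)) \ κ T.1.1).card := by
        refine Finset.card_le_card fun i hi => ?_
        have hi' := (Finset.mem_filter.1 hi).2
        rw [Finset.mem_sdiff, Finset.mem_filter]
        refine ⟨⟨Finset.mem_univ _, hi'.trans (Nat.cast_le.2 (Nat.mul_le_mul_left _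
          (Finset.card_le_card (Finset.filter_subset _ _))))⟩, fun hiκ => ?_⟩
        refine absurd (hi'.trans (Nat.cast_le.2 (Nat.mul_le_mul_left C
          (Finset.card_le_card fun a ha => ?_)))) (not_le.2 (hG i))
        exact (Finset.mem_filter.1 ha).2 hiκ
      rw [Finset.card_sdiff_of_subset hκT] at h1
      exact h1.trans (tsub_le_tsub (hd T hT) (hκ T.1))
    · rintro q ⟨⟨T, hT, hqT⟩, hqG⟩
      refine ⟨cut T, List.mem_map_of_mem (List.mem_filter.2
        ⟨hT, decide_eq_true (hlong T hT q hqT hqG)⟩), fun i => ?_⟩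
      rw [T.2.cellSector_eq hqT] at hqG
      exact Finset.mem_filter.2 ⟨hqT i, hqG i⟩
  · intro hdl
    refine Set.eq_empty_of_forall_notMem ?_
    rintro q ⟨⟨T, hT, hqT⟩, hqG⟩
    have h1 := Finset.card_le_card (hlong T hT q hqT hqG)
    have h2 := hd T hT
    have h3 := hκ T.1
    rw [Hypertube.dim] at h2
    omega

end Geometry

/-! ### Descent on the dimension, and the theorem -/

section Main

variable {l r : ℕ} {S : SeedCodes (l + r)}

/-- Every logical Pauli operator has a representative supported in a region that meets a given
covered set in lower dimension. -/
theorem exists_logical_pauli (hl : 1 ≤ l) (hlr : l ≤ r) {m C d : ℕ} (hmC : m < C)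
    (hC : ∀ i, ((C * kMax (S.A i) : ℕ) : ℕ∞) < dMin (S.A i)) {k : ℕ}
    {L : Fin k → CellAt S l → ZMod 2} (hL : IsLogicalBasis (xStab S l) (zStab S l) L)
    {X : Set (CellAt S l)} (hX : Covered m C d X) :
    ∃ Y : Set (CellAt S l), Covered (m + m) C (d - l) (X ∩ Y) ∧ (d < l → X ∩ Y = ∅) ∧
      ∀ a b : Fin k → ZMod 2, ∃ v w : CellAt S l → ZMod 2,
        Implements (encoder (xStab S l) L) (pauli v w) (pauli a b) ∧
        (∀ q, v q ≠ 0 → q ∈ Y) ∧ ∀ q, w q ≠ 0 → q ∈ Y := by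
  have hXZ := xStab_orthogonal_zStab S hl
  obtain ⟨Ts, hTs, hd, hTX⟩ := hX
  obtain ⟨F, hFd, hF⟩ := exists_short_positions hmC hTs
  obtain ⟨G, hG, hGv⟩ := exists_cocycle_representative S hl F hFd
  obtain ⟨G', hG', hGw⟩ := exists_cycle_representative S hl F hFd
  have small : ∀ {G : ∀ j, Finset (Fin (S.n j) ⊕ Fin (S.m j))},
      (∀ j, Disjoint (G j) (F j) ∧ (G j).card ≤ kMax (S.A j)) →
      ∀ i, ((C * (G i).card : ℕ) : ℕ∞) < dMin (S.A i) := fun hG i =>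
    lt_of_le_of_lt (Nat.cast_le.2 (Nat.mul_le_mul_left _ (hG i).2)) (hC i)
  obtain ⟨c1, e1⟩ := covered_inter_thin hTs hd hF (fun i => (hG i).1) (small hG) (fun μ => μ)
    (fun μ => μ.2.ge)
  -- The `Z` representatives are thin along the complement of the sector, which has `r ≥ l` axes.
  obtain ⟨c2, e2⟩ := covered_inter_thin hTs hd hF (fun i => (hG' i).1) (small hG')
    (fun μ => μᶜ) (fun μ => by rw [Finset.card_compl, Fintype.card_fin, μ.2]; omega)
  have hsub : X ∩ ({q | ∀ i ∈ cellSector q.1, q.1 i ∈ G i} ∪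
      {q | ∀ i ∈ (cellSector q.1)ᶜ, q.1 i ∈ G' i}) ⊆
      {q : CellAt S l | (∃ T ∈ Ts, q ∈ T.2.region) ∧ ∀ i ∈ cellSector q.1, q.1 i ∈ G i} ∪
      {q : CellAt S l | (∃ T ∈ Ts, q ∈ T.2.region) ∧
        ∀ i ∈ (cellSector q.1)ᶜ, q.1 i ∈ G' i} := by
    rintro q ⟨hqX, hq | hq⟩
    exacts [Or.inl ⟨hTX q hqX, hq⟩, Or.inr ⟨hTX q hqX, hq⟩]
  refine ⟨{q | ∀ i ∈ cellSector q.1, q.1 i ∈ G i} ∪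
    {q | ∀ i ∈ (cellSector q.1)ᶜ, q.1 i ∈ G' i},
    (c1.union c2).mono le_rfl le_rfl le_rfl hsub, fun hdl => ?_, fun a b => ?_⟩
  · rw [e1 hdl, e2 hdl, Set.union_empty] at hsub
    exact Set.subset_empty_iff.1 hsub
  -- The `X` and `Z` parts are cleaned separately; the stabilizers added in doing so leave the
  -- encoded action unchanged.
  · obtain ⟨v, hv, hvY⟩ := hGv (∑ i, a i • L i) fun b hb => hL.dotProduct_sum_smul hb a
    obtain ⟨w₀, hw₀, hw₀L⟩ := hL.exists_dual b
    obtain ⟨w, hw, hwY⟩ := hGw w₀ fun s hs => by rw [dotProduct_comm, hw₀ s hs]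
    refine ⟨v, w, (implements_pauliX hv).mul (implements_pauliZ (fun s hs => ?_) fun i => ?_),
      fun q hq => Or.inl (hvY q hq), fun q hq => Or.inr (hwY q hq)⟩
    · rw [← sub_add_cancel w w₀, add_dotProduct, hXZ s hs _ hw, hw₀ s hs, add_zero]
    · rw [← sub_add_cancel w w₀, add_dotProduct, hL.1 i _ hw, hw₀L, zero_add]

/-- A logical gate that spreads hypertubes boundedly and is supported on boundedly many hypertubes
of dimension less than `(s + 1) * l` acts on the logical qubits as a gate in level `s`. -/
theorem mem_projLevel_of_covered (hl : 1 ≤ l) (hlr : l ≤ r) (s : ℕ) :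
    ∀ (m d M : ℕ) (f : ℕ → ℕ), d < (s + 1) * l → ∃ C : ℕ, ∀ S : SeedCodes (l + r),
      (∀ i, ((C * kMax (S.A i) : ℕ) : ℕ∞) < dMin (S.A i)) →
      ∀ (k : ℕ) (L : Fin k → CellAt S l → ZMod 2),
        IsLogicalBasis (xStab S l) (zStab S l) L →
        ∀ (V : Op (CellAt S l)) (W : Op (Fin k)),
          Implements (encoder (xStab S l) L) V W → SpreadBound V M f → SpreadBound Vᴴ M f →
          Covered m C d (opSupport V) → W ∈ projLevel (Fin k) s := by
  induction s with
  | zero =>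
    intro m d M f hd
    refine ⟨m + 1, fun S hC k L hL V W hVW _ _ hcov => ?_⟩
    obtain ⟨Y, -, hY, hP⟩ := exists_logical_pauli hl hlr (Nat.lt_succ_self m) hC hL hcov
    have hE := encoder_isometry hL
    have hcomm : ∀ a b, Commute W (pauli a b) := fun a b => by
      obtain ⟨v, w, hvw, hv, hw⟩ := hP a b
      refine hVW.commute hE hvw (commute_of_disjoint_support subset_rfl ?_)
      refine (opSupport_pauli_subset hv hw).trans fun q hqY hq => ?_
      have : q ∈ opSupport V ∩ Y := ⟨hq, hqY⟩
      rw [hY (by simpa using hd)] at this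
      exact this
    refine exists_eq_smul_one_of_commutesAt fun q => ⟨?_, ?_⟩
    · simpa [pauli, pauliZ_zero] using hcomm (Pi.single q 1) 0
    · simpa [pauli, pauliX_zero] using hcomm 0 (Pi.single q 1)
  | succ s ih =>
    intro m d M f hd
    -- The subtraction is truncated, so for `d < l` the bound rests on `(s + 1) * l` being positive.
    have hd' : d - l < (s + 1) * l := by
      have h1 : (s + 1 + 1) * l = (s + 1) * l + l := by ring
      have h2 : 0 < (s + 1) * l := by positivity
      omega
    -- These are the parameters of the commutator: `m` tubes each for the `X` and `Z` parts, each
    -- spread by `V` into `M`, and spreading through `V†` and then `V`.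
    obtain ⟨C₁, hC₁⟩ := ih ((m + m) * M) (d - l) (M * M) (f ∘ f) hd'
    -- Cleaning needs `C > m`, the recursion needs `C ≥ C₁`, and covering the image under `V` at
    -- resolution `C₁` needs the cleaned intersection covered at resolution `f C₁`.
    refine ⟨m + 1 + C₁ + f C₁, fun S hC k L hL V W hVW hV hV' hcov => ?_⟩
    have hE := encoder_isometry hL
    obtain ⟨Y, hcov', -, hP⟩ := exists_logical_pauli hl hlr (by omega) hC hL hcov
    refine ⟨hVW.mem_unitaryGroup hE, fun a b => ?_⟩
    obtain ⟨v, w, hvw, hv, hw⟩ := hP a b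
    obtain ⟨hK, hK'⟩ := hV.pauliCommutator hV' hVW.1 v w
    refine hC₁ S (fun i => lt_of_le_of_lt (Nat.cast_le.2 (Nat.mul_le_mul_right _ ?_)) (hC i))
      k L hL (pauliCommutator V v w) _
      (((hVW.mul hvw).mul hVW.conjTranspose).mul hvw.conjTranspose) hK hK' ?_
    · omega
    · exact (hV.covered_supportMap hVW.1 (hcov'.mono le_rfl (by omega) le_rfl subset_rfl)).mono
        le_rfl le_rfl le_rfl (opSupport_pauliCommutator_subset V hv hw)

theorem IsDimensionPreserving.exists_spreadBound {t l : ℕ} {S : ℕ → SeedCodes t}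
    {U : ∀ N, Op (CellAt (S N) l)} (h : IsDimensionPreserving U) :
    ∃ (M : ℕ) (f : ℕ → ℕ), ∀ N, SpreadBound (U N) M f := by
  obtain ⟨M, h⟩ := h
  choose f hf using h
  refine ⟨M, f, fun N C μ R => ?_⟩
  obtain ⟨ν, T, hT, hsub⟩ := hf C N μ R
  refine ⟨List.ofFn fun a => ⟨ν a, T a⟩, by simp, fun T' hT' => ?_, fun q hq => ?_⟩
  · obtain ⟨a, rfl⟩ := (List.mem_ofFn' _ _).1 hT'
    exact hT a
  · obtain ⟨a, ha⟩ := Set.mem_iUnion.1 (hsub hq)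
    exact ⟨⟨ν a, T a⟩, (List.mem_ofFn' _ _).2 ⟨a, rfl⟩, ha⟩

/-- The spare multiple of `k` turns the asymptotic inequality into a strict one; for `k = 0`
strictness comes from `1 ≤ d`. -/
theorem mul_lt_of_succ_mul_le {C k : ℕ} {d : ℕ∞} (hd : 1 ≤ d)
    (h : (((C + 1) * k : ℕ) : ℕ∞) ≤ d) : ((C * k : ℕ) : ℕ∞) < d := by
  rcases Nat.eq_zero_or_pos k with rfl | hk
  · simpa using Order.one_le_iff_pos.1 hd
  · refine lt_of_lt_of_le (Nat.cast_lt.2 ?_) h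
    nlinarith

end Main
end HGP

theorem mainTheorem2 (l r : ℕ) (hl : 1 ≤ l) (hlr : l ≤ r)
    (S : ℕ → HGP.SeedCodes (l + r))
    (hkd : ∀ i : Fin (l + r), ∀ C : ℕ, ∀ᶠ N in Filter.atTop,
      ((C * HGP.kMax ((S N).A i) : ℕ) : ℕ∞) ≤ HGP.dMin ((S N).A i))
    (U : ∀ N, HGP.Op (HGP.CellAt (S N) l))
    (hlogical : ∀ N, HGP.IsLogicalGate (HGP.xStab (S N) l) (HGP.zStab (S N) l) (U N))
    (hdepth : HGP.IsConstantDepth U)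
    (hshape : HGP.IsShapePreserving U)
    (hdim : HGP.IsDimensionPreserving U)
    (hdim_inv : HGP.IsDimensionPreserving fun N => (U N)ᴴ) :
    ∀ᶠ N in Filter.atTop, ∀ (k : ℕ) (L : Fin k → HGP.CellAt (S N) l → ZMod 2),
      HGP.IsLogicalBasis (HGP.xStab (S N) l) (HGP.zStab (S N) l) L →
        HGP.encodedGate (HGP.xStab (S N) l) L (U N) ∈
          HGP.cliffordHierarchy (Fin k) (r / l + 1) := by
  obtain ⟨M₁, f₁, h₁⟩ := hdim.exists_spreadBound
  obtain ⟨M₂, f₂, h₂⟩ := hdim_inv.exists_spreadBound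
  -- Lowering `l + r` by `l` in each of `r / l + 1` commutators leaves less than `l`.
  have hd : l + r < (r / l + 1 + 1) * l := by
    have := Nat.lt_mul_div_succ r (show 0 < l by omega)
    nlinarith
  obtain ⟨C, hC⟩ := HGP.mem_projLevel_of_covered hl hlr (r / l + 1)
    (Fintype.card (HGP.Sector (l + r) l)) (l + r) (max M₁ M₂) (fun C => max (f₁ C) (f₂ C)) hd
  filter_upwards [Filter.eventually_all.2 fun i => hkd i (C + 1)] with N hN k L hL
  have hmem := hC (S N) (fun i => HGP.mul_lt_of_succ_mul_le (HGP.one_le_dMin _) (hN i)) k L hL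
    (U N) _ ((hlogical N).implements (HGP.xStab_orthogonal_zStab (S N) hl) hL)
    ((h₁ N).mono (le_max_left _ _) fun _ => le_max_left _ _)
    ((h₂ N).mono (le_max_right _ _) fun _ => le_max_right _ _)
    ((HGP.covered_univ C).mono le_rfl le_rfl le_rfl (Set.subset_univ _))
  -- As `l ≤ r`, the level is at least two, where membership up to phases suffices.
  obtain ⟨s, hs⟩ : ∃ s, r / l = s + 1 :=
    Nat.exists_eq_succ_of_ne_zero (Nat.div_pos hlr (by omega)).ne'
  rw [hs] at hmem ⊢
  exact HGP.projLevel_add_two_subset s hmem
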